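/- Let $a<0<b$, let $U$ be a smooth real-valued function on $[a,b]$, and let $\Psi,\Phi,\Upsilon_1,\Upsilon_2\in C^\infty(\mathbb R)$ be real-valued functions vanishing outside $[-1,1]$, with $\operatorname{supp}\Psi=[-1,1]$. Let $\alpha,\beta,\gamma_1,\gamma_2\in\mathbb R$. For $\varepsilon\in(0,1)$ let $\mathcal S_\varepsilon$ be the operator in $L_2(a,b)$ $$\mathcal S_\varepsilon f=f^{(4)}+Uf+\Big(\alpha\varepsilon^{-4}\Psi(\varepsilon^{-1}x)+\beta\varepsilon^{-3}\Phi(\varepsilon^{-1}x)+\gamma_1\varepsilon^{-2}\Upsilon_1(\varepsilon^{-1}x)+\gamma_2\varepsilon^{-1}\Upsilon_2(\varepsilon^{-1}x)\Big)f$$ with domain $\{f\in W_2^4(a,b): f(a)=f'(a)=f(b)=f'(b)=0\}$. The resonant set $\Sigma_\Psi$ is the set of all $\alpha\in\mathbb R$ for which the problem $$w^{(4)}+\alpha\Psi w=0\ \text{ on }(-1,1),\qquad w''(\pm1)=w'''(\pm1)=0$$ has a nontrivial solution. Assume that, if $\alpha\in\Sigma_\Psi$, then $\alpha$ is a simple eigenvalue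 of this problem and its real eigenfunction $w_\alpha$ satisfies $w_\alpha'(-1)w_\alpha'(1)\neq0$; in this case set $\theta_\Psi(\alpha)=w_\alpha'(1)/w_\alpha'(-1)$. Define the limit operator $\mathcal S_{\alpha,\beta}(\Psi,\Phi)$ in $L_2(a,b)$ as follows; it acts by $f\mapsto f^{(4)}+Uf$ on $(a,0)\cup(0,b)$. * If $\alpha\notin\Sigma_\Psi$, it is $S_-\oplus S_+$, where $S_-$ and $S_+$ are the operators $f\mapsto f^{(4)}+Uf$ in $L_2(a,0)$ and $L_2(0,b)$ with domains $\{f\in W_2^4(a,0): f(a)=f'(a)=f(0)=f'(0)=0\}$ and $\{f\in W_2^4(0,b): f(0)=f'(0)=f(b)=f'(b)=0\}$. * If $\alpha\in\Sigma_\Psi$, its domain consists of all $f\in W_2^4((a,0)\cup(0,b))$ with $f(a)=f'(a)=f(b)=f'(b)=0$, $f(-0)=f(+0)=0$, $f'(+0)-\theta_\Psi(\alpha)f'(-0)=0$ and $$\theta_\Psi(\alpha)f''(+0)-f''(-0)-\beta f'(-0)\int_{-1}^1\Phi(\xi)\Big(\frac{w_\alpha(\xi)}{w_\alpha'(-1)}\Big)^2d\xi=0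 .$$ Let $\mathcal I\subset(0,1)$ have $0$ as an accumulation point. For $\varepsilon\in\mathcal I$ let $\lambda^\varepsilon$ be an eigenvalue of $\mathcal S_\varepsilon$ and let $y_\varepsilon$ be a corresponding eigenfunction with $\|y_\varepsilon\|_{L_2(a,b)}=1$. If $\lambda^\varepsilon\to\lambda$ and $y_\varepsilon\to v$ weakly in $L_2(a,b)$ as $\mathcal I\ni\varepsilon\to0$, then $\lambda$ is an eigenvalue of $\mathcal S_{\alpha,\beta}(\Psi,\Phi)$ with the eigenfunction $v$ (in particular $v\ne0$), and $y_\varepsilon\to v$ in the norm of $L_2(a,b)$ as $\mathcal I\ni\varepsilon\to0$. -/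

import Mathlib

open MeasureTheory Set Filter Topology
open scoped ContDiff

noncomputable section

namespace SingularFourthOrder

/-- The Hilbert space `L_2(c,d)` with scalars `𝕜` (real or complex). -/
abbrev L2 (𝕜 : Type*) [RCLike 𝕜] (c d : ℝ) : Type _ :=
  Lp 𝕜 2 (volume.restrict (Ioo c d))

/-- `F 0` is an element of the Sobolev space `W_2^4(c,d)` and `F 1, F 2, F 3, F 4` are its
derivatives: on `[c,d]` each `F k` with `k < 4` is an absolutely continuous function with derivative
`F (k+1)` (it is the primitive of `F (k+1)`), and `F 4` lies in `L_2(c,d)`.  So for `k < 4` the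
values `F k c` and `F k d` are the one-sided boundary values of the `k`-th derivative. -/
structure IsSobolevJet {𝕜 : Type*} [RCLike 𝕜] (c d : ℝ) (F : Fin 5 → ℝ → 𝕜) : Prop where
  memLp : MemLp (F 4) 2 (volume.restrict (Ioo c d))
  primitive : ∀ k : Fin 4, ∀ x ∈ Icc c d,
    F k.castSucc x = F k.castSucc c + ∫ t in c..x, F k.succ t

/-- `f ∈ W_2^4(c,d)` with derivatives `F`, and `g = f'''' + Q f` on `(c,d)`. -/
structure ActsBy {𝕜 : Type*} [RCLike 𝕜] (c d : ℝ) (Q : ℝ → ℝ) (F : Fin 5 → ℝ → 𝕜)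
    (f g : ℝ → 𝕜) : Prop where
  jet : IsSobolevJet c d F
  eq_fst : f =ᵐ[volume.restrict (Ioo c d)] F 0
  eq_snd : g =ᵐ[volume.restrict (Ioo c d)] fun x => F 4 x + (Q x : 𝕜) * F 0 x

/-- `f ∈ W_2^4(c,d)`, `f(c) = f'(c) = f(d) = f'(d) = 0` and `g = f'''' + Q f` on `(c,d)`. -/
def DirichletActs {𝕜 : Type*} [RCLike 𝕜] (c d : ℝ) (Q : ℝ → ℝ) (f g : ℝ → 𝕜) : Prop :=
  ∃ F : Fin 5 → ℝ → 𝕜, ActsBy c d Q F f g ∧ F 0 c = 0 ∧ F 1 c = 0 ∧ F 0 d = 0 ∧ F 1 d = 0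

/-- `f ∈ W_2^4((a,0) ∪ (0,b))`, `f(a) = f'(a) = f(b) = f'(b) = 0`, `f(-0) = f(+0) = 0`,
`f'(+0) = θ f'(-0)`, `θ f''(+0) - f''(-0) = κ f'(-0)`, and `g = f'''' + Q f` on
`(a,0) ∪ (0,b)`.  Here `F` and `G` are the derivatives of `f` on `(a,0)` and on `(0,b)`. -/
def CoupledActs {𝕜 : Type*} [RCLike 𝕜] (a b : ℝ) (Q : ℝ → ℝ) (θ κ : ℝ) (f g : ℝ → 𝕜) : Prop :=
  ∃ F G : Fin 5 → ℝ → 𝕜, ActsBy a 0 Q F f g ∧ ActsBy 0 b Q G f g ∧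
    (F 0 a = 0 ∧ F 1 a = 0) ∧ (G 0 b = 0 ∧ G 1 b = 0) ∧
    (F 0 0 = 0 ∧ G 0 0 = 0) ∧
    G 1 0 - (θ : 𝕜) * F 1 0 = 0 ∧
    (θ : 𝕜) * G 2 0 - F 2 0 - (κ : 𝕜) * F 1 0 = 0

section Helpers

variable {𝕜 : Type*} [RCLike 𝕜] {a b c d : ℝ} {Q : ℝ → ℝ}

theorem IsSobolevJet.integrableOn_four {F : Fin 5 → ℝ → 𝕜} (hF : IsSobolevJet c d F) :
    IntegrableOn (F 4) (Icc c d) := by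
  rw [integrableOn_Icc_iff_integrableOn_Ioo]
  exact hF.memLp.integrable (by norm_num)

theorem IsSobolevJet.continuousOn_of_integrableOn {F : Fin 5 → ℝ → 𝕜} (hF : IsSobolevJet c d F)
    (k : Fin 4) (h : IntegrableOn (F k.succ) (Icc c d)) :
    ContinuousOn (F k.castSucc) (Icc c d) := by
  have h1 : ContinuousOn (fun x => F k.castSucc c + ∫ t in c..x, F k.succ t) (Icc c d) := by
    refine continuousOn_const.add ?_
    have := intervalIntegral.continuousOn_primitive (a := c) (b := d) h
    refine this.congr fun x hx => ?_
    exact intervalIntegral.integral_of_le hx.1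
  exact h1.congr fun x hx => hF.primitive k x hx

theorem IsSobolevJet.continuousOn {F : Fin 5 → ℝ → 𝕜} (hF : IsSobolevJet c d F) (k : Fin 4) :
    ContinuousOn (F k.castSucc) (Icc c d) := by
  have h3 := hF.continuousOn_of_integrableOn 3 hF.integrableOn_four
  have h2 := hF.continuousOn_of_integrableOn 2 (h3.integrableOn_compact isCompact_Icc)
  have h1 := hF.continuousOn_of_integrableOn 1 (h2.integrableOn_compact isCompact_Icc)
  have h0 := hF.continuousOn_of_integrableOn 0 (h1.integrableOn_compact isCompact_Icc)
  fin_cases k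
  · exact h0
  · exact h1
  · exact h2
  · exact h3

theorem IsSobolevJet.integrableOn {F : Fin 5 → ℝ → 𝕜} (hF : IsSobolevJet c d F) (k : Fin 5) :
    IntegrableOn (F k) (Icc c d) := by
  refine Fin.lastCases ?_ (fun k => ?_) k
  · exact hF.integrableOn_four
  · exact (hF.continuousOn k).integrableOn_compact isCompact_Icc

theorem IsSobolevJet.intervalIntegrable {F : Fin 5 → ℝ → 𝕜} (hF : IsSobolevJet c d F) (k : Fin 5)
    {x : ℝ} (hx : x ∈ Icc c d) : IntervalIntegrable (F k) volume c x := by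
  rw [intervalIntegrable_iff_integrableOn_Icc_of_le hx.1]
  exact (hF.integrableOn k).mono_set (Icc_subset_Icc_right hx.2)

theorem IsSobolevJet.zero : IsSobolevJet c d (0 : Fin 5 → ℝ → 𝕜) :=
  ⟨MemLp.zero, fun k x _ => by simp⟩

theorem IsSobolevJet.add {F G : Fin 5 → ℝ → 𝕜} (hF : IsSobolevJet c d F)
    (hG : IsSobolevJet c d G) : IsSobolevJet c d (F + G) := by
  refine ⟨hF.memLp.add hG.memLp, fun k x hx => ?_⟩
  simp only [Pi.add_apply]
  rw [intervalIntegral.integral_add (hF.intervalIntegrable _ hx) (hG.intervalIntegrable _ hx),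
    hF.primitive k x hx, hG.primitive k x hx]
  ring

theorem IsSobolevJet.smul {F : Fin 5 → ℝ → 𝕜} (r : 𝕜) (hF : IsSobolevJet c d F) :
    IsSobolevJet c d (r • F) := by
  refine ⟨hF.memLp.const_smul r, fun k x hx => ?_⟩
  simp only [Pi.smul_apply]
  rw [intervalIntegral.integral_smul, hF.primitive k x hx, smul_add]

theorem IsSobolevJet.succ_ae_zero {F : Fin 5 → ℝ → 𝕜} (hF : IsSobolevJet c d F) (k : Fin 4)
    (h : F k.castSucc =ᵐ[volume.restrict (Ioo c d)] 0) :
    F k.succ =ᵐ[volume.restrict (Ioo c d)] 0 := by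
  rcases le_or_gt d c with hdc | hcd
  · simp [Ioo_eq_empty_of_le hdc, Filter.EventuallyEq]
  have h0 : EqOn (F k.castSucc) 0 (Ioo c d) :=
    Measure.eqOn_open_of_ae_eq h isOpen_Ioo
      ((hF.continuousOn k).mono Ioo_subset_Icc_self) continuousOn_const
  have hi := hF.intervalIntegrable k.succ (right_mem_Icc.2 hcd.le)
  refine (ae_restrict_iff' measurableSet_Ioo).2 ?_
  filter_upwards [hi.ae_hasDerivAt_integral] with x hx hxI
  have hx' := hx (by rw [uIcc_of_le hcd.le]; exact Ioo_subset_Icc_self hxI) c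
    (by rw [uIcc_of_le hcd.le]; exact left_mem_Icc.2 hcd.le)
  have hc : (fun y => ∫ t in c..y, F k.succ t) =ᶠ[𝓝 x] fun _ => -F k.castSucc c := by
    filter_upwards [Ioo_mem_nhds hxI.1 hxI.2] with y hy
    have h1 := hF.primitive k y (Ioo_subset_Icc_self hy)
    rw [h0 hy] at h1
    exact (neg_eq_of_add_eq_zero_right h1.symm).symm
  exact hx'.unique ((hasDerivAt_const x (-F k.castSucc c)).congr_of_eventuallyEq hc)

theorem ActsBy.zero : ActsBy c d Q (0 : Fin 5 → ℝ → 𝕜) 0 0 :=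
  ⟨.zero, .rfl, Filter.Eventually.of_forall fun x => by simp⟩

theorem ActsBy.add {F F' : Fin 5 → ℝ → 𝕜} {f g f' g' : ℝ → 𝕜} (h : ActsBy c d Q F f g)
    (h' : ActsBy c d Q F' f' g') : ActsBy c d Q (F + F') (f + f') (g + g') := by
  refine ⟨h.jet.add h'.jet, h.eq_fst.add h'.eq_fst, ?_⟩
  filter_upwards [h.eq_snd, h'.eq_snd] with x hx hx'
  simp only [Pi.add_apply, hx, hx']
  ring

theorem ActsBy.smul {F : Fin 5 → ℝ → 𝕜} {f g : ℝ → 𝕜} (r : 𝕜) (h : ActsBy c d Q F f g) :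
    ActsBy c d Q (r • F) (r • f) (r • g) := by
  refine ⟨h.jet.smul r, h.eq_fst.const_smul r, ?_⟩
  filter_upwards [h.eq_snd] with x hx
  simp only [Pi.smul_apply, hx, smul_eq_mul]
  ring

theorem ActsBy.congr {F : Fin 5 → ℝ → 𝕜} {f g f' g' : ℝ → 𝕜} (h : ActsBy c d Q F f g)
    (hf : f' =ᵐ[volume.restrict (Ioo c d)] f) (hg : g' =ᵐ[volume.restrict (Ioo c d)] g) :
    ActsBy c d Q F f' g' :=
  ⟨h.jet, hf.trans h.eq_fst, hg.trans h.eq_snd⟩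

/-- The action is determined by the function: the operators below are well defined. -/
theorem ActsBy.ae_zero {F : Fin 5 → ℝ → 𝕜} {f g : ℝ → 𝕜} (h : ActsBy c d Q F f g)
    (hf : f =ᵐ[volume.restrict (Ioo c d)] 0) : g =ᵐ[volume.restrict (Ioo c d)] 0 := by
  have h0 : F 0 =ᵐ[volume.restrict (Ioo c d)] 0 := h.eq_fst.symm.trans hf
  have h1 := h.jet.succ_ae_zero 0 h0
  have h2 := h.jet.succ_ae_zero 1 h1
  have h3 := h.jet.succ_ae_zero 2 h2
  have h4 : F 4 =ᵐ[volume.restrict (Ioo c d)] 0 := h.jet.succ_ae_zero 3 h3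
  filter_upwards [h.eq_snd, h0, h4] with x hx hx0 hx4
  rw [hx, hx0, hx4]
  simp

theorem restrict_left_le (hb : 0 ≤ b) :
    volume.restrict (Ioo a 0) ≤ volume.restrict (Ioo a b) :=
  Measure.restrict_mono (Ioo_subset_Ioo_right hb) le_rfl

theorem restrict_right_le (ha : a ≤ 0) :
    volume.restrict (Ioo 0 b) ≤ volume.restrict (Ioo a b) :=
  Measure.restrict_mono (Ioo_subset_Ioo_left ha) le_rfl

theorem ae_split {p : ℝ → Prop} (h₁ : ∀ᵐ x ∂volume.restrict (Ioo a 0), p x)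
    (h₂ : ∀ᵐ x ∂volume.restrict (Ioo 0 b), p x) : ∀ᵐ x ∂volume.restrict (Ioo a b), p x := by
  rw [ae_restrict_iff' measurableSet_Ioo] at h₁ h₂ ⊢
  filter_upwards [h₁, h₂, Measure.ae_ne volume (0 : ℝ)] with x hx₁ hx₂ hx0 hx
  rcases lt_or_gt_of_ne hx0 with h | h
  · exact hx₁ ⟨hx.1, h⟩
  · exact hx₂ ⟨h, hx.2⟩

theorem DirichletActs.zero : DirichletActs c d Q (0 : ℝ → 𝕜) 0 :=
  ⟨0, .zero, by simp⟩

theorem DirichletActs.add {f g f' g' : ℝ → 𝕜} (h : DirichletActs c d Q f g)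
    (h' : DirichletActs c d Q f' g') : DirichletActs c d Q (f + f') (g + g') := by
  obtain ⟨F, hF, e1, e2, e3, e4⟩ := h
  obtain ⟨F', hF', e1', e2', e3', e4'⟩ := h'
  exact ⟨F + F', hF.add hF', by simp [*], by simp [*], by simp [*], by simp [*]⟩

theorem DirichletActs.smul {f g : ℝ → 𝕜} (r : 𝕜) (h : DirichletActs c d Q f g) :
    DirichletActs c d Q (r • f) (r • g) := by
  obtain ⟨F, hF, e1, e2, e3, e4⟩ := h
  exact ⟨r • F, hF.smul r, by simp [*], by simp [*], by simp [*], by simp [*]⟩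

theorem DirichletActs.congr {f g f' g' : ℝ → 𝕜} (h : DirichletActs c d Q f g)
    (hf : f' =ᵐ[volume.restrict (Ioo c d)] f) (hg : g' =ᵐ[volume.restrict (Ioo c d)] g) :
    DirichletActs c d Q f' g' := by
  obtain ⟨F, hF, e⟩ := h
  exact ⟨F, hF.congr hf hg, e⟩

theorem CoupledActs.zero {θ κ : ℝ} : CoupledActs a b Q θ κ (0 : ℝ → 𝕜) 0 :=
  ⟨0, 0, .zero, .zero, by simp⟩

theorem CoupledActs.add {θ κ : ℝ} {f g f' g' : ℝ → 𝕜} (h : CoupledActs a b Q θ κ f g)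
    (h' : CoupledActs a b Q θ κ f' g') : CoupledActs a b Q θ κ (f + f') (g + g') := by
  obtain ⟨F, G, hF, hG, ⟨e1, e2⟩, ⟨e3, e4⟩, ⟨e5, e6⟩, e7, e8⟩ := h
  obtain ⟨F', G', hF', hG', ⟨e1', e2'⟩, ⟨e3', e4'⟩, ⟨e5', e6'⟩, e7', e8'⟩ := h'
  refine ⟨F + F', G + G', hF.add hF', hG.add hG', by simp [*], by simp [*], by simp [*], ?_, ?_⟩
  · simp only [Pi.add_apply]
    linear_combination e7 + e7'
  · simp only [Pi.add_apply]
    linear_combination e8 + e8'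

theorem CoupledActs.smul {θ κ : ℝ} {f g : ℝ → 𝕜} (r : 𝕜) (h : CoupledActs a b Q θ κ f g) :
    CoupledActs a b Q θ κ (r • f) (r • g) := by
  obtain ⟨F, G, hF, hG, ⟨e1, e2⟩, ⟨e3, e4⟩, ⟨e5, e6⟩, e7, e8⟩ := h
  refine ⟨r • F, r • G, hF.smul r, hG.smul r, by simp [*], by simp [*], by simp [*], ?_, ?_⟩
  · simp only [Pi.smul_apply, smul_eq_mul]
    linear_combination r * e7
  · simp only [Pi.smul_apply, smul_eq_mul]
    linear_combination r * e8

theorem CoupledActs.congr {θ κ : ℝ} {f g f' g' : ℝ → 𝕜} (h : CoupledActs a b Q θ κ f g)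
    (hf : f' =ᵐ[volume.restrict (Ioo a 0)] f) (hg : g' =ᵐ[volume.restrict (Ioo a 0)] g)
    (hf₂ : f' =ᵐ[volume.restrict (Ioo 0 b)] f) (hg₂ : g' =ᵐ[volume.restrict (Ioo 0 b)] g) :
    CoupledActs a b Q θ κ f' g' := by
  obtain ⟨F, G, hF, hG, e⟩ := h
  exact ⟨F, G, hF.congr hf hg, hG.congr hf₂ hg₂, e⟩

end Helpers

section Operators

variable (𝕜 : Type*) [RCLike 𝕜]

/-- The graph of `d⁴/dx⁴ + Q` in `L_2(a,b)` with the Dirichlet conditions at `a` and `b`. -/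
def dirichletGraph (a b : ℝ) (Q : ℝ → ℝ) : Submodule 𝕜 (L2 𝕜 a b × L2 𝕜 a b) where
  carrier := {p | DirichletActs a b Q p.1 p.2}
  zero_mem' := DirichletActs.zero.congr (Lp.coeFn_zero _ _ _) (Lp.coeFn_zero _ _ _)
  add_mem' {p q} hp hq :=
    (DirichletActs.add hp hq).congr (Lp.coeFn_add p.1 q.1) (Lp.coeFn_add p.2 q.2)
  smul_mem' r p hp :=
    (DirichletActs.smul r hp).congr (Lp.coeFn_smul r p.1) (Lp.coeFn_smul r p.2)

/-- The operator `f ↦ f'''' + Q f` in `L_2(a,b)` with the domain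
`{f ∈ W_2^4(a,b) : f(a) = f'(a) = f(b) = f'(b) = 0}`. -/
def dirichletOperator (a b : ℝ) (Q : ℝ → ℝ) : L2 𝕜 a b →ₗ.[𝕜] L2 𝕜 a b :=
  (dirichletGraph 𝕜 a b Q).toLinearPMap

/-- The graph in `L_2(a,b) = L_2(a,0) ⊕ L_2(0,b)` of the direct sum of the Dirichlet operators
`f ↦ f'''' + Q f` on `(a,0)` and on `(0,b)`. -/
def directSumGraph (a b : ℝ) (ha : a ≤ 0) (hb : 0 ≤ b) (Q : ℝ → ℝ) :
    Submodule 𝕜 (L2 𝕜 a b × L2 𝕜 a b) where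
  carrier := {p | DirichletActs a 0 Q p.1 p.2 ∧ DirichletActs 0 b Q p.1 p.2}
  zero_mem' := by
    have h := Lp.coeFn_zero 𝕜 2 (volume.restrict (Ioo a b))
    have h₁ := ae_mono (restrict_left_le (a := a) hb) h
    have h₂ := ae_mono (restrict_right_le (b := b) ha) h
    exact ⟨DirichletActs.zero.congr h₁ h₁, DirichletActs.zero.congr h₂ h₂⟩
  add_mem' {p q} hp hq := by
    have h := Lp.coeFn_add p.1 q.1
    have h' := Lp.coeFn_add p.2 q.2
    exact ⟨(hp.1.add hq.1).congr (ae_mono (restrict_left_le hb) h)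
        (ae_mono (restrict_left_le hb) h'),
      (hp.2.add hq.2).congr (ae_mono (restrict_right_le ha) h)
        (ae_mono (restrict_right_le ha) h')⟩
  smul_mem' r p hp := by
    have h := Lp.coeFn_smul r p.1
    have h' := Lp.coeFn_smul r p.2
    exact ⟨(hp.1.smul r).congr (ae_mono (restrict_left_le hb) h)
        (ae_mono (restrict_left_le hb) h'),
      (hp.2.smul r).congr (ae_mono (restrict_right_le ha) h)
        (ae_mono (restrict_right_le ha) h')⟩

/-- The direct sum `S_- ⊕ S_+` of the Dirichlet operators on `(a,0)` and on `(0,b)`. -/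
def directSumOperator (a b : ℝ) (ha : a ≤ 0) (hb : 0 ≤ b) (Q : ℝ → ℝ) :
    L2 𝕜 a b →ₗ.[𝕜] L2 𝕜 a b :=
  (directSumGraph 𝕜 a b ha hb Q).toLinearPMap

/-- The graph in `L_2(a,b)` of the operator with coupling conditions at the origin. -/
def coupledGraph (a b : ℝ) (ha : a ≤ 0) (hb : 0 ≤ b) (Q : ℝ → ℝ) (θ κ : ℝ) :
    Submodule 𝕜 (L2 𝕜 a b × L2 𝕜 a b) where
  carrier := {p | CoupledActs a b Q θ κ p.1 p.2}
  zero_mem' := by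
    have h := Lp.coeFn_zero 𝕜 2 (volume.restrict (Ioo a b))
    have h₁ := ae_mono (restrict_left_le (a := a) hb) h
    have h₂ := ae_mono (restrict_right_le (b := b) ha) h
    exact CoupledActs.zero.congr h₁ h₁ h₂ h₂
  add_mem' {p q} hp hq := by
    have h := Lp.coeFn_add p.1 q.1
    have h' := Lp.coeFn_add p.2 q.2
    exact (CoupledActs.add hp hq).congr (ae_mono (restrict_left_le hb) h)
      (ae_mono (restrict_left_le hb) h') (ae_mono (restrict_right_le ha) h)
      (ae_mono (restrict_right_le ha) h')
  smul_mem' r p hp := by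
    have h := Lp.coeFn_smul r p.1
    have h' := Lp.coeFn_smul r p.2
    exact (CoupledActs.smul r hp).congr (ae_mono (restrict_left_le hb) h)
      (ae_mono (restrict_left_le hb) h') (ae_mono (restrict_right_le ha) h)
      (ae_mono (restrict_right_le ha) h')

/-- The operator `f ↦ f'''' + Q f` on `(a,0) ∪ (0,b)`, with the Dirichlet conditions at `a` and `b`
and the coupling conditions `f(0) = 0`, `f'(+0) - θ f'(-0) = 0` and
`θ f''(+0) - f''(-0) - κ f'(-0) = 0` at the origin. -/
def coupledOperator (a b : ℝ) (ha : a ≤ 0) (hb : 0 ≤ b) (Q : ℝ → ℝ) (θ κ : ℝ) :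
    L2 𝕜 a b →ₗ.[𝕜] L2 𝕜 a b :=
  (coupledGraph 𝕜 a b ha hb Q θ κ).toLinearPMap

variable {𝕜}

/-- The graph defining `dirichletOperator` is single-valued. -/
theorem dirichletOperator_graph (a b : ℝ) (Q : ℝ → ℝ) :
    (dirichletOperator 𝕜 a b Q).graph = dirichletGraph 𝕜 a b Q := by
  refine Submodule.toLinearPMap_graph_eq _ fun p hp h0 => ?_
  obtain ⟨F, hF, -⟩ := hp
  refine (Lp.eq_zero_iff_ae_eq_zero).2 (hF.ae_zero ?_)
  rw [h0]
  exact Lp.coeFn_zero _ _ _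

/-- The graph defining `directSumOperator` is single-valued. -/
theorem directSumOperator_graph (a b : ℝ) (ha : a ≤ 0) (hb : 0 ≤ b) (Q : ℝ → ℝ) :
    (directSumOperator 𝕜 a b ha hb Q).graph = directSumGraph 𝕜 a b ha hb Q := by
  refine Submodule.toLinearPMap_graph_eq _ fun p hp h0 => ?_
  obtain ⟨⟨F, hF, -⟩, ⟨G, hG, -⟩⟩ := hp
  have h : p.1 =ᵐ[volume.restrict (Ioo a b)] 0 := by
    rw [h0]
    exact Lp.coeFn_zero _ _ _
  exact (Lp.eq_zero_iff_ae_eq_zero).2 (ae_split (hF.ae_zero (ae_mono (restrict_left_le hb) h))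
    (hG.ae_zero (ae_mono (restrict_right_le ha) h)))

/-- The graph defining `coupledOperator` is single-valued. -/
theorem coupledOperator_graph (a b : ℝ) (ha : a ≤ 0) (hb : 0 ≤ b) (Q : ℝ → ℝ) (θ κ : ℝ) :
    (coupledOperator 𝕜 a b ha hb Q θ κ).graph = coupledGraph 𝕜 a b ha hb Q θ κ := by
  refine Submodule.toLinearPMap_graph_eq _ fun p hp h0 => ?_
  obtain ⟨F, G, hF, hG, -⟩ := hp
  have h : p.1 =ᵐ[volume.restrict (Ioo a b)] 0 := by
    rw [h0]
    exact Lp.coeFn_zero _ _ _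
  exact (Lp.eq_zero_iff_ae_eq_zero).2 (ae_split (hF.ae_zero (ae_mono (restrict_left_le hb) h))
    (hG.ae_zero (ae_mono (restrict_right_le ha) h)))

/-- `μ` is an eigenvalue of the (unbounded) operator `T` with the eigenvector `f`. -/
def IsEigenpair {H : Type*} [AddCommGroup H] [Module 𝕜 H] (T : H →ₗ.[𝕜] H) (μ : 𝕜) (f : H) :
    Prop :=
  f ≠ 0 ∧ ∃ hf : f ∈ T.domain, T ⟨f, hf⟩ = μ • f

end Operators

/-- A shape function: a real function of the class `C^∞` on the line that vanishes
outside `[-1,1]`. -/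
def IsShape (f : ℝ → ℝ) : Prop :=
  ContDiff ℝ ∞ f ∧ tsupport f ⊆ Icc (-1) 1

/-- The singular perturbation
`α ε⁻⁴ Ψ(x/ε) + β ε⁻³ Φ(x/ε) + γ₁ ε⁻² Υ₁(x/ε) + γ₂ ε⁻¹ Υ₂(x/ε)`. -/
def perturbation (α β γ₁ γ₂ : ℝ) (Ψ Φ Υ₁ Υ₂ : ℝ → ℝ) (ε x : ℝ) : ℝ :=
  α * (ε ^ 4)⁻¹ * Ψ (ε⁻¹ * x) + β * (ε ^ 3)⁻¹ * Φ (ε⁻¹ * x) +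
    γ₁ * (ε ^ 2)⁻¹ * Υ₁ (ε⁻¹ * x) + γ₂ * ε⁻¹ * Υ₂ (ε⁻¹ * x)

/-- The operator `S_ε` with smooth coefficients, with the Dirichlet conditions at `a` and `b`. -/
def perturbedOperator (𝕜 : Type*) [RCLike 𝕜] (a b : ℝ) (U : ℝ → ℝ) (α β γ₁ γ₂ : ℝ)
    (Ψ Φ Υ₁ Υ₂ : ℝ → ℝ) (ε : ℝ) : L2 𝕜 a b →ₗ.[𝕜] L2 𝕜 a b :=
  dirichletOperator 𝕜 a b fun x => U x + perturbation α β γ₁ γ₂ Ψ Φ Υ₁ Υ₂ ε x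

/-- `W 0` (with derivatives `W 1, …, W 4`) is a solution of `w'''' + α Ψ w = 0` on `(-1,1)`,
`w''(-1) = w'''(-1) = w''(1) = w'''(1) = 0`. -/
structure IsResonanceSolution (Ψ : ℝ → ℝ) (α : ℝ) (W : Fin 5 → ℝ → ℝ) : Prop where
  jet : IsSobolevJet (-1) 1 W
  eq : ∀ᵐ ξ ∂volume.restrict (Ioo (-1 : ℝ) 1), W 4 ξ + α * Ψ ξ * W 0 ξ = 0
  left : W 2 (-1) = 0 ∧ W 3 (-1) = 0
  right : W 2 1 = 0 ∧ W 3 1 = 0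

/-- `W 0` (with derivatives `W 1, …, W 4`) is an eigenfunction for the eigenvalue `α`. -/
def IsResonanceEigenfunction (Ψ : ℝ → ℝ) (α : ℝ) (W : Fin 5 → ℝ → ℝ) : Prop :=
  IsResonanceSolution Ψ α W ∧ ∃ ξ ∈ Icc (-1 : ℝ) 1, W 0 ξ ≠ 0

/-- The resonant set `Σ_Ψ`: the set of real `α` for which
`w'''' + α Ψ w = 0`, `w''(±1) = w'''(±1) = 0` has a nontrivial solution. -/
def resonantSet (Ψ : ℝ → ℝ) : Set ℝ :=
  {α | ∃ W : Fin 5 → ℝ → ℝ, IsResonanceEigenfunction Ψ α W}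

/-- The resonance is nondegenerate: the eigenvalue `α` is simple, and `w'(-1) w'(1) ≠ 0` for its
eigenfunctions `w`. -/
def IsNondegenerate (Ψ : ℝ → ℝ) (α : ℝ) : Prop :=
  ∀ W : Fin 5 → ℝ → ℝ, IsResonanceEigenfunction Ψ α W →
    (∀ V : Fin 5 → ℝ → ℝ, IsResonanceSolution Ψ α V →
      ∃ r : ℝ, ∀ ξ ∈ Icc (-1 : ℝ) 1, V 0 ξ = r * W 0 ξ) ∧
    W 1 (-1) * W 1 1 ≠ 0

open scoped Classical in
/-- An eigenfunction `w_α` (with its derivatives) for `α ∈ Σ_Ψ`. -/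
def resonanceEigenfunction (Ψ : ℝ → ℝ) (α : ℝ) : Fin 5 → ℝ → ℝ :=
  if h : α ∈ resonantSet Ψ then h.choose else 0

/-- `θ_Ψ(α) = w_α'(1) / w_α'(-1)`. -/
def theta (Ψ : ℝ → ℝ) (α : ℝ) : ℝ :=
  resonanceEigenfunction Ψ α 1 1 / resonanceEigenfunction Ψ α 1 (-1)

/-- The functional `ϑ_Φ[f] = ∫_{-1}^1 Φ f²`. -/
def vartheta (Φ f : ℝ → ℝ) : ℝ :=
  ∫ ξ in (-1 : ℝ)..1, Φ ξ * f ξ ^ 2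

open scoped Classical in
/-- The limit operator `S_{α,β}(Ψ,Φ)`: the direct sum `S_- ⊕ S_+` if `α ∉ Σ_Ψ`, and the operator
`d⁴/dx⁴ + U` with the coupling conditions `f(0) = 0`, `f'(+0) = θ_Ψ(α) f'(-0)`,
`θ_Ψ(α) f''(+0) - f''(-0) = β ϑ_Φ[w_α / w_α'(-1)] f'(-0)` if `α ∈ Σ_Ψ`. -/
def limitOperator (𝕜 : Type*) [RCLike 𝕜] (a b : ℝ) (ha : a ≤ 0) (hb : 0 ≤ b) (U : ℝ → ℝ)
    (α β : ℝ) (Ψ Φ : ℝ → ℝ) : L2 𝕜 a b →ₗ.[𝕜] L2 𝕜 a b :=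
  if α ∈ resonantSet Ψ then
    coupledOperator 𝕜 a b ha hb U (theta Ψ α)
      (β * vartheta Φ fun ξ =>
        resonanceEigenfunction Ψ α 0 ξ / resonanceEigenfunction Ψ α 1 (-1))
  else
    directSumOperator 𝕜 a b ha hb U

end SingularFourthOrder

end

open SingularFourthOrder

/-! Off `(-ε, ε)` the eigenfunction `y_ε` solves `y'''' + (U - λ^ε) y = 0`, a linear system with
uniformly convergent coefficients. The bound on `‖y_ε‖` bounds its `L_1` norm on `[a, a/2]`. This
bounds the Cauchy data at `a`: otherwise the solutions, divided by the norm of their data, would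
converge to a solution with unit data that vanishes on `[a, a/2]`. Hence, along an ultrafilter,
`y_ε` and its first three derivatives converge uniformly on `[a, -ε]` to a solution `A` on `[a, 0]`,
endpoint values at `-ε` included. The same holds on the right, with a limit `B`
(`exists_isSol_limit_left`, `exists_isSol_limit_right`).

Inside, `z(ξ) = ε⁻¹ y_ε(εξ)` solves `z'''' + (αΨ + ε(βΦ + o(1))) z = 0`. Its slopes at `±1` converge
to `A'(0)` and `B'(0)`, while `z''(±1)` and `z'''(±1)` are `O(ε)`. If `z` were unbounded, its
normalisation would converge to a nontrivial resonance solution with zero slope at `-1`, which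
nondegeneracy excludes. So `z` converges to a resonance solution `W` with slopes `A'(0)`, `B'(0)`,
and `y_ε(±ε) = ε z(±1)` tends to `0` (`exists_inner_limit`).

Without resonance `W = 0`, which gives the Dirichlet conditions. At resonance `W` is a multiple of
`w_α`, so `B'(0) = θ A'(0)`. The condition on second derivatives is the solvability condition at
order `ε`: the Lagrange identity for `z` and `w_α`, divided by `ε`, passes to the limit
(`coupling_second_derivative`).

Since `y_ε` stays bounded on `[-ε, ε]`, it converges in norm (`tendsto_L2_of_uniform_off`). The norm
limit must be `v`, and it has norm one, so it is nonzero. Ultrafilters play the role of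
subsequences: a limit that is the same along all of them is the limit along the filter. -/

noncomputable section

namespace SingularFourthOrder

/-! ### Linear systems: existence, stability and limits of solutions -/

section LinearSystem

variable {𝕜 : Type*} [RCLike 𝕜]

/-- The right-hand side of `x'''' = -q x` written as a first order system. -/
def companion (q : 𝕜) (x : Fin 4 → 𝕜) : Fin 4 → 𝕜 := ![x 1, x 2, x 3, -(q * x 0)]

theorem companion_sub (q : 𝕜) (x y : Fin 4 → 𝕜) :
    companion q (x - y) = companion q x - companion q y := by
  ext k
  fin_cases k <;> simp [companion]; ring

theorem companion_smul (q r : 𝕜) (x : Fin 4 → 𝕜) :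
    companion q (r • x) = r • companion q x := by
  ext k
  fin_cases k <;> simp [companion]; ring

theorem norm_companion_le {q : 𝕜} {K : ℝ} (hK : 1 ≤ K) (hq : ‖q‖ ≤ K) (x : Fin 4 → 𝕜) :
    ‖companion q x‖ ≤ K * ‖x‖ := by
  have h (k : Fin 4) : ‖x k‖ ≤ K * ‖x‖ :=
    (norm_le_pi_norm x k).trans (le_mul_of_one_le_left (norm_nonneg x) hK)
  refine (pi_norm_le_iff_of_nonneg (by positivity)).2 fun k => ?_
  fin_cases k
  · exact h 1
  · exact h 2
  · exact h 3
  · simp only [companion, Fin.reduceFinMk, Matrix.cons_val, norm_neg, norm_mul]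
    exact mul_le_mul hq (norm_le_pi_norm x 0) (norm_nonneg _) (by positivity)

theorem norm_companion_sub_companion_le (q q' : 𝕜) (x : Fin 4 → 𝕜) :
    ‖companion q x - companion q' x‖ ≤ ‖q - q'‖ * ‖x‖ := by
  refine (pi_norm_le_iff_of_nonneg (by positivity)).2 fun k => ?_
  fin_cases k
  · simpa [companion] using mul_nonneg (norm_nonneg (q - q')) (norm_nonneg x)
  · simpa [companion] using mul_nonneg (norm_nonneg (q - q')) (norm_nonneg x)
  · simpa [companion] using mul_nonneg (norm_nonneg (q - q')) (norm_nonneg x)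
  · simp only [companion, Fin.reduceFinMk, Pi.sub_apply, Matrix.cons_val]
    rw [show -(q * x 0) - -(q' * x 0) = -((q - q') * x 0) by ring, norm_neg, norm_mul]
    gcongr
    exact norm_le_pi_norm x 0

theorem continuousOn_companion {q : ℝ → 𝕜} {x : ℝ → Fin 4 → 𝕜} {s : Set ℝ}
    (hq : ContinuousOn q s) (hx : ContinuousOn x s) :
    ContinuousOn (fun t => companion (q t) (x t)) s := by
  have h (k : Fin 4) : ContinuousOn (fun t => x t k) s :=
    (continuous_apply k).comp_continuousOn hx
  refine continuousOn_pi.2 fun k => ?_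
  fin_cases k
  · exact h 1
  · exact h 2
  · exact h 3
  · exact (hq.mul (h 0)).neg

/-- `X` is a solution on `[c,d]` of the first order system for `x'''' + q x = 0`. -/
def IsSol (c d : ℝ) (q : ℝ → 𝕜) (X : ℝ → Fin 4 → 𝕜) : Prop :=
  ∀ t ∈ Icc c d, HasDerivWithinAt X (companion (q t) (X t)) (Icc c d) t

namespace IsSol

variable {c d c' d' : ℝ} {q q' : ℝ → 𝕜} {X Y : ℝ → Fin 4 → 𝕜}

theorem continuousOn (h : IsSol c d q X) : ContinuousOn X (Icc c d) :=
  fun t ht => (h t ht).continuousWithinAt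

theorem continuousOn_apply (h : IsSol c d q X) (k : Fin 4) :
    ContinuousOn (fun t => X t k) (Icc c d) :=
  (continuous_apply k).comp_continuousOn h.continuousOn

theorem mono (h : IsSol c d q X) (hc : c ≤ c') (hd : d' ≤ d) : IsSol c' d' q X :=
  fun t ht => (h t (Icc_subset_Icc hc hd ht)).mono (Icc_subset_Icc hc hd)

theorem congr (h : IsSol c d q X) (hq : ∀ t ∈ Icc c d, q' t = q t) : IsSol c d q' X := by
  intro t ht
  rw [hq t ht]
  exact h t ht

theorem sub (h : IsSol c d q X) (h' : IsSol c d q Y) : IsSol c d q (fun t => X t - Y t) := by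
  intro t ht
  rw [companion_sub]
  exact (h t ht).sub (h' t ht)

theorem smul (r : 𝕜) (h : IsSol c d q X) : IsSol c d q (fun t => r • X t) := by
  intro t ht
  rw [companion_smul]
  exact (h t ht).const_smul r

theorem hasDerivWithinAt_apply (h : IsSol c d q X) {t : ℝ} (ht : t ∈ Icc c d) (k : Fin 4) :
    HasDerivWithinAt (fun t => X t k) (companion (q t) (X t) k) (Icc c d) t :=
  (hasDerivWithinAt_pi.1 (h t ht)) k

theorem of_hasDerivWithinAt
    (h : ∀ t ∈ Icc c d, ∀ k, HasDerivWithinAt (fun t => X t k) (companion (q t) (X t) k)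
      (Icc c d) t) : IsSol c d q X :=
  fun t ht => hasDerivWithinAt_pi.2 (h t ht)

/-- The change of variables `x = s ξ`. -/
theorem scale (h : IsSol c d q X) (s : ℝ) (hs : ∀ t ∈ Icc c' d', s * t ∈ Icc c d) :
    IsSol c' d' (fun t => (s : 𝕜) ^ 4 * q (s * t)) (fun t k => (s : 𝕜) ^ (k : ℕ) * X (s * t) k) := by
  refine of_hasDerivWithinAt fun t ht k => ?_
  have h1 : HasDerivWithinAt (fun t : ℝ => s * t) s (Icc c' d') t := by
    simpa using (hasDerivWithinAt_id t (Icc c' d')).const_mul s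
  have h2 := ((h.hasDerivWithinAt_apply (hs t ht) k).scomp t h1 hs).const_mul ((s : 𝕜) ^ (k : ℕ))
  convert! h2 using 1
  fin_cases k <;> simp [companion, RCLike.real_smul_eq_coe_mul] <;> ring

/-- Each of the first three equations of the system says that a component is the derivative of the
previous one, so vanishing propagates; `c < d` makes the one-sided derivatives unique. -/
theorem eq_zero_of_apply_zero (h : IsSol c d q X) (hcd : c < d)
    (h0 : ∀ t ∈ Icc c d, X t 0 = 0) : ∀ t ∈ Icc c d, X t = 0 := by
  have step (k k' : Fin 4) (hk : ∀ t, companion (q t) (X t) k = X t k')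
      (hz : ∀ t ∈ Icc c d, X t k = 0) : ∀ t ∈ Icc c d, X t k' = 0 := by
    intro t ht
    have h1 := h.hasDerivWithinAt_apply ht k
    have h2 : HasDerivWithinAt (fun t => X t k) 0 (Icc c d) t :=
      (hasDerivWithinAt_const t (Icc c d) (0 : 𝕜)).congr hz (hz t ht)
    rw [← hk]
    exact (uniqueDiffOn_Icc hcd t ht).eq_deriv _ h1 h2
  have h1 := step 0 1 (fun t => rfl) h0
  have h2 := step 1 2 (fun t => rfl) h1
  have h3 := step 2 3 (fun t => rfl) h2
  intro t ht
  ext k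
  fin_cases k
  · exact h0 t ht
  · exact h1 t ht
  · exact h2 t ht
  · exact h3 t ht

end IsSol

/-- Grönwall's bound contains `η / K`; the convention `K ≥ 1` allows replacing it by `η`. -/
theorem norm_le_mul_exp_of_norm_deriv_le {E : Type*} [NormedAddCommGroup E] [NormedSpace ℝ E]
    {f f' : ℝ → E} {c d K η : ℝ} (hK : 1 ≤ K) (hη : 0 ≤ η)
    (hf : ∀ t ∈ Icc c d, HasDerivWithinAt f (f' t) (Icc c d) t)
    (hb : ∀ t ∈ Icc c d, ‖f' t‖ ≤ K * ‖f t‖ + η) {t : ℝ} (ht : t ∈ Icc c d) :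
    ‖f t‖ ≤ (‖f c‖ + η) * Real.exp (K * (d - c)) := by
  have h := norm_le_gronwallBound_of_norm_deriv_right_le
    (fun t ht => (hf t ht).continuousWithinAt)
    (fun t ht => (hf t (Ico_subset_Icc_self ht)).mono_of_mem_nhdsWithin
      (Icc_mem_nhdsGE_of_mem ht)) (le_refl ‖f c‖)
    (fun t ht => hb t (Ico_subset_Icc_self ht)) t ht
  rw [gronwallBound_of_K_ne_0 (by positivity)] at h
  have hexp : Real.exp (K * (t - c)) ≤ Real.exp (K * (d - c)) := by
    gcongr
    exact ht.2
  have h2 : η / K ≤ η := div_le_self hη hK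
  have h3 : 0 ≤ η / K := by positivity
  calc ‖f t‖ ≤ _ := h
    _ ≤ ‖f c‖ * Real.exp (K * (d - c)) + η * Real.exp (K * (d - c)) :=
      add_le_add (mul_le_mul_of_nonneg_left hexp (norm_nonneg _))
        (mul_le_mul h2 (by linarith) (by linarith [Real.one_le_exp (mul_nonneg
          (zero_le_one.trans hK) (sub_nonneg.2 ht.1))]) hη)
    _ = _ := by ring

/-- The radial retraction onto the ball of radius `R`. -/
def radialRetraction {E : Type*} [NormedAddCommGroup E] [NormedSpace ℝ E] (R : ℝ) (x : E) : E :=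
  (R / max R ‖x‖) • x

section Retraction

variable {E : Type*} [NormedAddCommGroup E] [NormedSpace ℝ E] {R : ℝ}

theorem radialRetraction_of_norm_le (hR : 0 < R) {x : E} (hx : ‖x‖ ≤ R) :
    radialRetraction R x = x := by
  rw [radialRetraction, max_eq_left hx, div_self hR.ne', one_smul]

theorem norm_radialRetraction (hR : 0 < R) (x : E) :
    ‖radialRetraction R x‖ = R / max R ‖x‖ * ‖x‖ := by
  rw [radialRetraction, norm_smul, Real.norm_of_nonneg (by positivity)]

theorem norm_radialRetraction_le (hR : 0 < R) (x : E) : ‖radialRetraction R x‖ ≤ R := by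
  rw [norm_radialRetraction hR, div_mul_eq_mul_div]
  refine div_le_of_le_mul₀ (by positivity) hR.le ?_
  gcongr
  exact le_max_right _ _

theorem norm_radialRetraction_le_norm (hR : 0 < R) (x : E) : ‖radialRetraction R x‖ ≤ ‖x‖ := by
  rw [norm_radialRetraction hR]
  exact mul_le_of_le_one_left (norm_nonneg x)
    (div_le_one_of_le₀ (le_max_left _ _) (by positivity))

/-- The difference splits into moving the point with the factor fixed and changing the factor with
the point fixed. Each part costs at most `‖x - y‖`, hence the constant `2`, in any normed space. -/
theorem norm_radialRetraction_sub_le (hR : 0 < R) (x y : E) :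
    ‖radialRetraction R x - radialRetraction R y‖ ≤ 2 * ‖x - y‖ := by
  have hp : 0 < max R ‖x‖ := lt_max_of_lt_left hR
  have hq : 0 < max R ‖y‖ := lt_max_of_lt_left hR
  have e : radialRetraction R x - radialRetraction R y =
      (R / max R ‖x‖) • (x - y) + (R / max R ‖x‖ - R / max R ‖y‖) • y := by
    simp only [radialRetraction]
    module
  have h1 : ‖(R / max R ‖x‖) • (x - y)‖ ≤ ‖x - y‖ := by
    rw [norm_smul, Real.norm_of_nonneg (by positivity)]
    exact mul_le_of_le_one_left (norm_nonneg _) (div_le_one_of_le₀ (le_max_left _ _) hp.le)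
  have h2 : ‖(R / max R ‖x‖ - R / max R ‖y‖) • y‖ ≤ ‖x - y‖ := by
    have e2 : R / max R ‖x‖ - R / max R ‖y‖ =
        (R / max R ‖x‖) * ((max R ‖y‖ - max R ‖x‖) / max R ‖y‖) := by
      field_simp
    have h3 : |max R ‖y‖ - max R ‖x‖| ≤ ‖x - y‖ := by
      rw [abs_sub_comm]
      rw [max_comm R, max_comm R]
      exact (abs_max_sub_max_le_abs _ _ _).trans (abs_norm_sub_norm_le x y)
    rw [norm_smul, e2, Real.norm_eq_abs, abs_mul,
      abs_of_nonneg (by positivity : 0 ≤ R / max R ‖x‖), abs_div (max R ‖y‖ - _), abs_of_pos hq]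
    calc R / max R ‖x‖ * (|max R ‖y‖ - max R ‖x‖| / max R ‖y‖) * ‖y‖
        ≤ 1 * (|max R ‖y‖ - max R ‖x‖| / max R ‖y‖) * max R ‖y‖ := by
          gcongr
          · exact div_le_one_of_le₀ (le_max_left _ _) hp.le
          · exact le_max_right _ _
      _ = |max R ‖y‖ - max R ‖x‖| := by field_simp
      _ ≤ _ := h3
  rw [e]
  linarith [norm_add_le ((R / max R ‖x‖) • (x - y)) ((R / max R ‖x‖ - R / max R ‖y‖) • y)]

end Retraction

theorem exists_norm_le_of_continuousOn {c d : ℝ} {E : Type*} [NormedAddCommGroup E] {q : ℝ → E}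
    (hq : ContinuousOn q (Icc c d)) : ∃ K : ℝ, 1 ≤ K ∧ ∀ t ∈ Icc c d, ‖q t‖ ≤ K := by
  obtain ⟨K, hK⟩ := isCompact_Icc.exists_bound_of_continuousOn hq
  exact ⟨max 1 K, le_max_left _ _, fun t ht => (hK t ht).trans (le_max_right _ _)⟩

/-- A linear field is unbounded, so Picard–Lindelöf alone gives only short-time solutions. Truncated
by `radialRetraction`, the field is bounded and Lipschitz, and a solution exists on all of `[c,d]`.
Grönwall keeps it in the ball where the truncation does nothing. -/
theorem exists_isSol {c d : ℝ} (hcd : c ≤ d) {q : ℝ → 𝕜} (hq : ContinuousOn q (Icc c d))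
    (x₀ : Fin 4 → 𝕜) : ∃ X, IsSol c d q X ∧ X c = x₀ := by
  obtain ⟨K, hK1, hK⟩ := exists_norm_le_of_continuousOn hq
  have hK0 : 0 ≤ K := zero_le_one.trans hK1
  -- Grönwall's bound with `η = 1`; the slack keeps `R` positive when `x₀ = 0`.
  set R : ℝ := (‖x₀‖ + 1) * Real.exp (K * (d - c)) with hR
  have hR0 : 0 < R := by positivity
  have hPL : IsPicardLindelof (fun t x => companion (q t) (radialRetraction R x))
      (⟨c, left_mem_Icc.2 hcd⟩ : Icc c d) x₀ (⟨K * R * (d - c), by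
        have := sub_nonneg.2 hcd; positivity⟩) 0 (⟨K * R, by positivity⟩)
      (⟨K * 2, by positivity⟩) := by
    refine ⟨fun t ht => ?_, fun x _ => ?_, fun t ht x _ => ?_, ?_⟩
    · refine LipschitzWith.lipschitzOnWith (LipschitzWith.of_dist_le_mul fun x y => ?_)
      rw [dist_eq_norm, dist_eq_norm, ← companion_sub]
      refine (norm_companion_le hK1 (hK t ht) _).trans ?_
      change _ ≤ K * 2 * ‖x - y‖
      rw [mul_assoc]
      gcongr
      exact norm_radialRetraction_sub_le hR0 x y
    · exact continuousOn_companion hq continuousOn_const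
    · refine (norm_companion_le hK1 (hK t ht) _).trans ?_
      change _ ≤ K * R
      gcongr
      exact norm_radialRetraction_le hR0 x
    · simp [sub_nonneg.2 hcd]
      exact le_rfl
  obtain ⟨X, hXc, hX⟩ := hPL.exists_eq_forall_mem_Icc_hasDerivWithinAt₀
  refine ⟨X, fun t ht => ?_, hXc⟩
  have hb : ‖X t‖ ≤ R := by
    have := norm_le_mul_exp_of_norm_deriv_le hK1 zero_le_one hX (fun s hs => ?_) ht
    · simp only at hXc
      rwa [hXc] at this
    · refine (norm_companion_le hK1 (hK s hs) _).trans ?_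
      have := mul_le_mul_of_nonneg_left (norm_radialRetraction_le_norm hR0 (X s)) hK0
      linarith
  have := hX t ht
  rwa [radialRetraction_of_norm_le hR0 hb] at this

/-- The difference `X - Y` solves the system for `q` with an inhomogeneity of size at most `η * M`,
so Grönwall applies. -/
theorem IsSol.norm_sub_le {c d K η M : ℝ} {q q' : ℝ → 𝕜} {X Y : ℝ → Fin 4 → 𝕜}
    (hX : IsSol c d q X) (hY : IsSol c d q' Y) (hK1 : 1 ≤ K) (hK : ∀ t ∈ Icc c d, ‖q t‖ ≤ K)
    (hη0 : 0 ≤ η) (hη : ∀ t ∈ Icc c d, ‖q t - q' t‖ ≤ η) (hM0 : 0 ≤ M)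
    (hM : ∀ t ∈ Icc c d, ‖Y t‖ ≤ M) {t : ℝ} (ht : t ∈ Icc c d) :
    ‖X t - Y t‖ ≤ (‖X c - Y c‖ + η * M) * Real.exp (K * (d - c)) := by
  refine norm_le_mul_exp_of_norm_deriv_le (f := fun t => X t - Y t) hK1 (by positivity)
    (fun t ht => (hX t ht).sub (hY t ht)) (fun t ht => ?_) ht
  have e : companion (q t) (X t) - companion (q' t) (Y t) =
      companion (q t) (X t - Y t) + (companion (q t) (Y t) - companion (q' t) (Y t)) := by
    rw [companion_sub]
    abel
  rw [e]
  refine (norm_add_le _ _).trans (add_le_add (norm_companion_le hK1 (hK t ht) _) ?_)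
  exact (norm_companion_sub_companion_le _ _ _).trans
    (mul_le_mul (hη t ht) (hM t ht) (norm_nonneg _) hη0)

/-- Solutions with convergent coefficients and convergent initial data converge uniformly to
a solution of the limit system. -/
theorem exists_isSol_limit {ι : Type*} {l : Filter ι} {c d : ℝ} (hcd : c ≤ d) {q : ℝ → 𝕜}
    (hq : ContinuousOn q (Icc c d)) {e : ι → ℝ} {p : ι → ℝ → 𝕜} {X : ι → ℝ → Fin 4 → 𝕜}
    (he : ∀ᶠ i in l, c ≤ e i ∧ e i ≤ d) (hX : ∀ᶠ i in l, IsSol c (e i) (p i) (X i))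
    (hp : ∀ δ > 0, ∀ᶠ i in l, ∀ t ∈ Icc c (e i), ‖p i t - q t‖ ≤ δ)
    {x₀ : Fin 4 → 𝕜} (h0 : Tendsto (fun i => X i c) l (𝓝 x₀)) :
    ∃ W, IsSol c d q W ∧ W c = x₀ ∧
      ∀ δ > 0, ∀ᶠ i in l, ∀ t ∈ Icc c (e i), ‖X i t - W t‖ ≤ δ := by
  obtain ⟨W, hW, hWc⟩ := exists_isSol hcd hq x₀
  refine ⟨W, hW, hWc, fun δ hδ => ?_⟩
  obtain ⟨K, hK1, hK⟩ := exists_norm_le_of_continuousOn hq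
  obtain ⟨M, hM1, hM⟩ := exists_norm_le_of_continuousOn hW.continuousOn
  set B := Real.exp ((K + 1) * (d - c)) with hB
  have hB0 : 0 < B := Real.exp_pos _
  -- The bound `1` keeps the perturbed coefficients below `K + 1`; the other bound makes the
  -- coefficient error contribute at most `δ / 2`.
  set η := min 1 (δ / (2 * M * B)) with hη
  have hM0 : 0 < M := by linarith
  have hη0 : 0 < η := lt_min one_pos (by positivity)
  have h0' : ∀ᶠ i in l, ‖X i c - x₀‖ < δ / (2 * B) := by
    have := (tendsto_iff_norm_sub_tendsto_zero.1 h0).eventually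
      (gt_mem_nhds (show (0 : ℝ) < δ / (2 * B) by positivity))
    exact this
  filter_upwards [he, hX, hp η hη0, h0'] with i hei hXi hpi h0i t ht
  have hsub : Icc c (e i) ⊆ Icc c d := Icc_subset_Icc_right hei.2
  have hpK : ∀ t ∈ Icc c (e i), ‖p i t‖ ≤ K + 1 := by
    intro t ht
    have h1 := norm_le_norm_add_norm_sub' (p i t) (q t)
    have h2 := hpi t ht
    have h3 := hK t (hsub ht)
    have h4 : η ≤ 1 := min_le_left _ _
    linarith
  have h := hXi.norm_sub_le (hW.mono le_rfl hei.2) (by linarith) hpK hη0.le hpi hM0.le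
    (fun t ht => hM t (hsub ht)) ht
  refine h.trans ?_
  rw [hWc]
  have h5 : η * M ≤ δ / (2 * B) := by
    calc η * M ≤ δ / (2 * M * B) * M := by
          gcongr
          exact min_le_right _ _
      _ = δ / (2 * B) := by field_simp
  have h6 : Real.exp ((K + 1) * (e i - c)) ≤ B := by
    rw [hB]
    gcongr
    exact hei.2
  calc (‖X i c - x₀‖ + η * M) * Real.exp ((K + 1) * (e i - c))
      ≤ (δ / (2 * B) + δ / (2 * B)) * B := by gcongr
    _ = δ := by field_simp; ring

end LinearSystem

/-! ### Passage between Sobolev jets and classical solutions -/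

section Jets

variable {𝕜 : Type*} [RCLike 𝕜] {c d : ℝ}

theorem hasDerivWithinAt_of_eq_add_integral {f g : ℝ → 𝕜} (hcd : c ≤ d)
    (hg : ContinuousOn g (Icc c d)) (h : ∀ x ∈ Icc c d, f x = f c + ∫ t in c..x, g t) :
    ∀ x ∈ Icc c d, HasDerivWithinAt f (g x) (Icc c d) x := by
  intro x hx
  have := ODE.hasDerivWithinAt_picard_Icc (f := fun _ z => z) (u := univ) (α := g)
    (left_mem_Icc.2 hcd) continuous_snd.continuousOn hg (fun _ _ => mem_univ _) (f c) hx
  exact this.congr h (h x hx)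

theorem eq_add_integral_of_hasDerivWithinAt {f g : ℝ → 𝕜} (hg : ContinuousOn g (Icc c d))
    (h : ∀ x ∈ Icc c d, HasDerivWithinAt f (g x) (Icc c d) x) :
    ∀ x ∈ Icc c d, f x = f c + ∫ t in c..x, g t := by
  intro x hx
  have hsub : Icc c x ⊆ Icc c d := Icc_subset_Icc_right hx.2
  have hf : ContinuousOn f (Icc c d) := fun t ht => (h t ht).continuousWithinAt
  rw [intervalIntegral.integral_eq_sub_of_hasDeriv_right (f := f)]
  · ring
  · rw [uIcc_of_le hx.1]
    exact hf.mono hsub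
  · intro t ht
    rw [min_eq_left hx.1, max_eq_right hx.1] at ht
    exact (h t ⟨ht.1.le, ht.2.le.trans hx.2⟩).mono_of_mem_nhdsWithin
      (mem_of_superset (Icc_mem_nhdsGT_of_mem ⟨ht.1.le, ht.2⟩) hsub)
  · refine ContinuousOn.intervalIntegrable ?_
    rw [uIcc_of_le hx.1]
    exact hg.mono hsub

theorem IsSobolevJet.isSol {F : Fin 5 → ℝ → 𝕜} {q : ℝ → 𝕜} (hF : IsSobolevJet c d F)
    (hcd : c ≤ d) (hq : ContinuousOn q (Icc c d))
    (h : F 4 =ᵐ[volume.restrict (Ioo c d)] fun x => -(q x * F 0 x)) :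
    IsSol c d q fun t k => F k.castSucc t := by
  have hlast : ContinuousOn (fun x => -(q x * F 0 x)) (Icc c d) :=
    (hq.mul (hF.continuousOn 0)).neg
  refine IsSol.of_hasDerivWithinAt fun t ht k => ?_
  fin_cases k
  · exact hasDerivWithinAt_of_eq_add_integral hcd (hF.continuousOn 1) (hF.primitive 0) t ht
  · exact hasDerivWithinAt_of_eq_add_integral hcd (hF.continuousOn 2) (hF.primitive 1) t ht
  · exact hasDerivWithinAt_of_eq_add_integral hcd (hF.continuousOn 3) (hF.primitive 2) t ht
  · refine hasDerivWithinAt_of_eq_add_integral hcd hlast (fun x hx => ?_) t ht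
    -- `F 4` is known only almost everywhere, but `F 3` is also the primitive of the continuous
    -- representative, hence differentiable everywhere.
    refine (hF.primitive 3 x hx).trans (congrArg _ ?_)
    refine intervalIntegral.integral_congr_ae ?_
    filter_upwards [(ae_restrict_iff' measurableSet_Ioo).1 h, Measure.ae_ne volume d] with s hs hsd hsx
    rw [uIoc_of_le hx.1] at hsx
    exact hs ⟨hsx.1, lt_of_le_of_ne (hsx.2.trans hx.2) hsd⟩

theorem memLp_two_of_continuousOn {f : ℝ → 𝕜} (hf : ContinuousOn f (Icc c d)) :
    MemLp f 2 (volume.restrict (Ioo c d)) := by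
  obtain ⟨K, -, hK⟩ := exists_norm_le_of_continuousOn hf
  refine MemLp.of_bound ((hf.mono Ioo_subset_Icc_self).aestronglyMeasurable measurableSet_Ioo) K ?_
  filter_upwards [ae_restrict_mem measurableSet_Ioo] with x hx
  exact hK x (Ioo_subset_Icc_self hx)

/-- The derivatives up to the fourth order of a solution. -/
def solJet (q : ℝ → 𝕜) (X : ℝ → Fin 4 → 𝕜) : Fin 5 → ℝ → 𝕜 :=
  ![fun t => X t 0, fun t => X t 1, fun t => X t 2, fun t => X t 3, fun t => -(q t * X t 0)]

theorem IsSol.isSobolevJet {q : ℝ → 𝕜} {X : ℝ → Fin 4 → 𝕜} (h : IsSol c d q X)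
    (hq : ContinuousOn q (Icc c d)) : IsSobolevJet c d (solJet q X) := by
  have h4 : ContinuousOn (fun t => -(q t * X t 0)) (Icc c d) :=
    (hq.mul (h.continuousOn_apply 0)).neg
  refine ⟨memLp_two_of_continuousOn h4, fun k => ?_⟩
  fin_cases k
  · exact eq_add_integral_of_hasDerivWithinAt (h.continuousOn_apply 1)
      fun x hx => h.hasDerivWithinAt_apply hx 0
  · exact eq_add_integral_of_hasDerivWithinAt (h.continuousOn_apply 2)
      fun x hx => h.hasDerivWithinAt_apply hx 1
  · exact eq_add_integral_of_hasDerivWithinAt (h.continuousOn_apply 3)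
      fun x hx => h.hasDerivWithinAt_apply hx 2
  · exact eq_add_integral_of_hasDerivWithinAt h4 fun x hx => h.hasDerivWithinAt_apply hx 3

theorem IsSol.actsBy {Q : ℝ → ℝ} {μ : 𝕜} {X : ℝ → Fin 4 → 𝕜} {f g : ℝ → 𝕜}
    (h : IsSol c d (fun t => (Q t : 𝕜) - μ) X) (hQ : ContinuousOn Q (Icc c d))
    (hf : f =ᵐ[volume.restrict (Ioo c d)] fun t => X t 0)
    (hg : g =ᵐ[volume.restrict (Ioo c d)] fun t => μ * f t) :
    ActsBy c d Q (solJet (fun t => (Q t : 𝕜) - μ) X) f g := by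
  have hq : ContinuousOn (fun t => (Q t : 𝕜) - μ) (Icc c d) :=
    (RCLike.continuous_ofReal.comp_continuousOn hQ).sub continuousOn_const
  refine ⟨h.isSobolevJet hq, hf, ?_⟩
  filter_upwards [hf, hg] with t h1 h2
  rw [h2, h1]
  simp only [solJet, Matrix.cons_val]
  ring

end Jets

/-! ### Compactness of families of solutions along an ultrafilter -/

section Compactness

variable {𝕜 : Type*} [RCLike 𝕜] {ι : Type*} {l : Ultrafilter ι} {c d : ℝ}

theorem exists_tendsto_of_norm_le {E : Type*} [NormedAddCommGroup E] [ProperSpace E] {f : ι → E}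
    {C : ℝ} (h : ∀ᶠ i in l, ‖f i‖ ≤ C) : ∃ x, Tendsto f l (𝓝 x) := by
  obtain ⟨x, -, hx⟩ := (isCompact_closedBall (0 : E) C).ultrafilter_le_nhds (l.map f) (by
    simp only [le_principal_iff, Ultrafilter.coe_map, mem_map]
    filter_upwards [h] with i hi
    simpa using hi)
  exact ⟨x, hx⟩

theorem exists_eventually_le_or_tendsto_atTop (f : ι → ℝ) :
    (∃ C, ∀ᶠ i in l, f i ≤ C) ∨ Tendsto f l atTop := by
  refine or_iff_not_imp_left.2 fun h => tendsto_atTop.2 fun C => ?_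
  have h1 : ∀ᶠ i in l, ¬ f i ≤ C := Ultrafilter.eventually_not.2 fun h2 => h ⟨C, h2⟩
  filter_upwards [h1] with i hi using (not_le.1 hi).le

/-- A family of solutions converges along an ultrafilter, if no multiples of them with multipliers
tending to zero converge to a nonzero solution. -/
theorem exists_isSol_limit_of_normalized (hcd : c ≤ d) {q : ℝ → 𝕜}
    (hq : ContinuousOn q (Icc c d)) {e : ι → ℝ} {p : ι → ℝ → 𝕜} {X : ι → ℝ → Fin 4 → 𝕜}
    (he : ∀ᶠ i in l, c ≤ e i ∧ e i ≤ d) (hX : ∀ᶠ i in l, IsSol c (e i) (p i) (X i))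
    (hp : ∀ δ > 0, ∀ᶠ i in l, ∀ t ∈ Icc c (e i), ‖p i t - q t‖ ≤ δ)
    (hnz : ∀ (r : ι → ℝ) (W : ℝ → Fin 4 → 𝕜), Tendsto r l (𝓝 0) → IsSol c d q W →
      (∀ δ > 0, ∀ᶠ i in l, ∀ t ∈ Icc c (e i), ‖(r i : 𝕜) • X i t - W t‖ ≤ δ) → W c = 0) :
    ∃ W, IsSol c d q W ∧ Tendsto (fun i => X i c) l (𝓝 (W c)) ∧
      ∀ δ > 0, ∀ᶠ i in l, ∀ t ∈ Icc c (e i), ‖X i t - W t‖ ≤ δ := by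
  rcases exists_eventually_le_or_tendsto_atTop (l := l) (fun i => ‖X i c‖) with ⟨C, hC⟩ | hT
  · obtain ⟨x₀, hx₀⟩ := exists_tendsto_of_norm_le hC
    obtain ⟨W, hW, rfl, hlim⟩ := exists_isSol_limit hcd hq he hX hp hx₀
    exact ⟨W, hW, hx₀, hlim⟩
  · exfalso
    -- If the data blow up, dividing by their norm produces a limit solution with unit data, against
    -- `hnz`.
    set r : ι → ℝ := fun i => ‖X i c‖⁻¹ with hr
    have hr0 : Tendsto r l (𝓝 0) := tendsto_inv_atTop_zero.comp hT
    have h1 : ∀ᶠ i in l, ‖(r i : 𝕜) • X i c‖ = 1 := by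
      filter_upwards [hT.eventually (eventually_gt_atTop 0)] with i hi
      rw [norm_smul, RCLike.norm_ofReal, hr, abs_of_pos (inv_pos.2 hi), inv_mul_cancel₀ hi.ne']
    obtain ⟨x₀, hx₀⟩ := exists_tendsto_of_norm_le (h1.mono fun i hi => hi.le)
    obtain ⟨W, hW, rfl, hlim⟩ := exists_isSol_limit (X := fun i t => (r i : 𝕜) • X i t) hcd hq he
      (hX.mono fun i hi => hi.smul _) hp hx₀
    have h2 : ‖W c‖ = 1 :=
      tendsto_nhds_unique hx₀.norm (tendsto_const_nhds.congr' (h1.mono fun i hi => hi.symm))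
    rw [hnz r W hr0 hW hlim, norm_zero] at h2
    exact zero_ne_one h2

/-- Solutions on `[c, e i]` that are bounded in `L_1` on a fixed subinterval converge. -/
theorem exists_isSol_limit_of_integral_le {m : ℝ} (hcm : c < m) (hmd : m ≤ d) {q : ℝ → 𝕜}
    (hq : ContinuousOn q (Icc c d)) {e : ι → ℝ} {p : ι → ℝ → 𝕜} {X : ι → ℝ → Fin 4 → 𝕜}
    (he : ∀ᶠ i in l, m ≤ e i ∧ e i ≤ d) (hX : ∀ᶠ i in l, IsSol c (e i) (p i) (X i))
    (hp : ∀ δ > 0, ∀ᶠ i in l, ∀ t ∈ Icc c (e i), ‖p i t - q t‖ ≤ δ)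
    {C : ℝ} (hC : ∀ᶠ i in l, ∫ t in c..m, ‖X i t 0‖ ≤ C) :
    ∃ W, IsSol c d q W ∧ Tendsto (fun i => X i c) l (𝓝 (W c)) ∧
      ∀ δ > 0, ∀ᶠ i in l, ∀ t ∈ Icc c (e i), ‖X i t - W t‖ ≤ δ := by
  refine exists_isSol_limit_of_normalized (hcm.le.trans hmd) hq
    (he.mono fun i hi => ⟨hcm.le.trans hi.1, hi.2⟩) hX hp fun r W hr hW hlim => ?_
  have hWm := hW.mono le_rfl hmd
  have hWc : ContinuousOn (fun t => ‖W t 0‖) (Icc c m) := (hWm.continuousOn_apply 0).norm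
  -- The multipliers tend to zero while the integrals of `‖X i t 0‖` stay below `C`, so the limit
  -- has zero `L_1` norm on `[c,m]`. One half of `δ` pays for `|r i| * C`, the other for the uniform
  -- error.
  have hint : ∫ t in c..m, ‖W t 0‖ ≤ 0 := by
    refine le_of_forall_pos_le_add fun δ hδ => ?_
    have hδ1 : 0 < δ / (2 * (m - c)) := by have := sub_pos.2 hcm; positivity
    have h1 : ∀ᶠ i in l, |r i| * C < δ / 2 := by
      have h2 : Tendsto (fun i => |r i| * C) l (𝓝 (|0| * C)) := hr.abs.mul_const C
      exact h2.eventually (gt_mem_nhds (by simpa using half_pos hδ))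
    obtain ⟨i, hi1, hi2, hi3, hi4, hi5⟩ :=
      (h1.and (he.and (hX.and (hC.and (hlim _ hδ1))))).exists
    have hXc : ContinuousOn (fun t => ‖X i t 0‖) (Icc c m) :=
      ((hi3.mono le_rfl hi2.1).continuousOn_apply 0).norm
    have hXi : IntervalIntegrable (fun t => ‖X i t 0‖) volume c m :=
      ContinuousOn.intervalIntegrable (by rwa [uIcc_of_le hcm.le])
    have hle : ∫ t in c..m, ‖W t 0‖ ≤
        ∫ t in c..m, (|r i| * ‖X i t 0‖ + δ / (2 * (m - c))) := by
      refine intervalIntegral.integral_mono_on hcm.le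
        (ContinuousOn.intervalIntegrable (by rwa [uIcc_of_le hcm.le]))
        ((hXi.const_mul _).add intervalIntegrable_const) fun t ht => ?_
      have h3 := (norm_le_pi_norm _ 0).trans (hi5 t (Icc_subset_Icc_right hi2.1 ht))
      have h4 := norm_le_norm_add_norm_sub ((r i : 𝕜) * X i t 0) (W t 0)
      rw [norm_mul, RCLike.norm_ofReal] at h4
      simp only [Pi.sub_apply, Pi.smul_apply, smul_eq_mul] at h3
      linarith
    rw [intervalIntegral.integral_add (hXi.const_mul _) intervalIntegrable_const,
      intervalIntegral.integral_const_mul, intervalIntegral.integral_const, smul_eq_mul] at hle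
    have h5 : (m - c) * (δ / (2 * (m - c))) = δ / 2 := by
      have := (sub_pos.2 hcm).ne'
      field_simp
    have h6 : |r i| * ∫ t in c..m, ‖X i t 0‖ ≤ |r i| * C :=
      mul_le_mul_of_nonneg_left hi4 (abs_nonneg _)
    linarith
  have h0 : ∫ t in c..m, ‖W t 0‖ = 0 :=
    le_antisymm hint (intervalIntegral.integral_nonneg hcm.le fun t _ => norm_nonneg _)
  rw [intervalIntegral.integral_of_le hcm.le, integral_eq_zero_iff_of_nonneg
    (fun t => norm_nonneg _) ((hWc.integrableOn_compact isCompact_Icc).mono_set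
      Ioc_subset_Icc_self), Measure.restrict_congr_set Ioc_ae_eq_Icc] at h0
  have h1 : EqOn (fun t => ‖W t 0‖) 0 (Icc c m) :=
    Measure.eqOn_Icc_of_ae_eq volume hcm.ne h0 hWc continuousOn_const
  exact hWm.eq_zero_of_apply_zero hcm (fun t ht => norm_eq_zero.1 (h1 ht)) c
    (left_mem_Icc.2 hcm.le)

/-- The values at the right ends of the intervals converge as well. -/
theorem tendsto_apply_right {f : ι → ℝ → Fin 4 → 𝕜} {W : ℝ → Fin 4 → 𝕜} {e : ι → ℝ}
    (hW : ContinuousOn W (Icc c d)) (hcd : c ≤ d) (he : ∀ᶠ i in l, c ≤ e i ∧ e i ≤ d)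
    (hed : Tendsto e l (𝓝 d))
    (hlim : ∀ δ > 0, ∀ᶠ i in l, ∀ t ∈ Icc c (e i), ‖f i t - W t‖ ≤ δ) :
    Tendsto (fun i => f i (e i)) l (𝓝 (W d)) := by
  have h1 : Tendsto (fun i => W (e i)) l (𝓝 (W d)) :=
    (hW d (right_mem_Icc.2 hcd)).tendsto.comp
      (tendsto_nhdsWithin_iff.2 ⟨hed, he.mono fun i hi => hi⟩)
  have h2 : Tendsto (fun i => f i (e i) - W (e i)) l (𝓝 0) := by
    refine Metric.tendsto_nhds.2 fun δ hδ => ?_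
    filter_upwards [hlim (δ / 2) (half_pos hδ), he] with i hi hei
    rw [dist_zero_right]
    exact (hi _ (right_mem_Icc.2 hei.1)).trans_lt (half_lt_self hδ)
  simpa using h2.add h1

end Compactness

/-! ### Resonance solutions and the Lagrange identity -/

section Resonance

variable {𝕜 : Type*} [RCLike 𝕜] {c d : ℝ}

/-- A real coefficient commutes with real-linear functionals. Real and imaginary parts thus reduce
solutions over `𝕜` to the real problem that defines `resonantSet`. -/
theorem IsSol.map_clm {q : ℝ → ℝ} {X : ℝ → Fin 4 → 𝕜} (φ : 𝕜 →L[ℝ] ℝ)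
    (h : IsSol c d (fun t => (q t : 𝕜)) X) : IsSol c d q (fun t k => φ (X t k)) := by
  refine IsSol.of_hasDerivWithinAt fun t ht k => ?_
  convert! φ.hasFDerivAt.comp_hasDerivWithinAt t (h.hasDerivWithinAt_apply ht k) using 1
  fin_cases k
  · rfl
  · rfl
  · rfl
  · simp [companion, ← RCLike.real_smul_eq_coe_mul]

theorem IsSol.ofReal {q : ℝ → ℝ} {X : ℝ → Fin 4 → ℝ} (h : IsSol c d q X) :
    IsSol c d (fun t => (q t : 𝕜)) (fun t k => (X t k : 𝕜)) := by
  refine IsSol.of_hasDerivWithinAt fun t ht k => ?_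
  convert! (RCLike.ofRealCLM (K := 𝕜)).hasFDerivAt.comp_hasDerivWithinAt t
    (h.hasDerivWithinAt_apply ht k) using 1
  fin_cases k <;> simp [companion]

variable {Ψ : ℝ → ℝ} {α : ℝ}

theorem IsSol.isResonanceSolution (hΨ : Continuous Ψ) {X : ℝ → Fin 4 → ℝ}
    (h : IsSol (-1) 1 (fun t => α * Ψ t) X) (h2 : X (-1) 2 = 0 ∧ X 1 2 = 0)
    (h3 : X (-1) 3 = 0 ∧ X 1 3 = 0) :
    IsResonanceSolution Ψ α (solJet (fun t => α * Ψ t) X) := by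
  refine ⟨h.isSobolevJet (by fun_prop), Filter.Eventually.of_forall fun ξ => ?_,
    ⟨h2.1, h3.1⟩, ⟨h2.2, h3.2⟩⟩
  simp [solJet]

/-- A resonance solution whose first derivative vanishes at `-1` is trivial, and every resonance
solution is trivial if there is no resonance. -/
theorem IsSol.eq_zero_of_isNondegenerate (hΨ : Continuous Ψ)
    (hα : α ∈ resonantSet Ψ → IsNondegenerate Ψ α) {X : ℝ → Fin 4 → 𝕜}
    (h : IsSol (-1) 1 (fun t => ((α * Ψ t : ℝ) : 𝕜)) X) (h2 : X (-1) 2 = 0 ∧ X 1 2 = 0)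
    (h3 : X (-1) 3 = 0 ∧ X 1 3 = 0) (h1 : α ∈ resonantSet Ψ → X (-1) 1 = 0) :
    ∀ t ∈ Icc (-1 : ℝ) 1, X t = 0 := by
  -- If this part were nonzero it would be an eigenfunction. Then `α` is resonant, so the slope at
  -- `-1` is zero by `h1`, which contradicts nondegeneracy. Both cases are thus treated at once.
  have key (φ : 𝕜 →L[ℝ] ℝ) : ∀ t ∈ Icc (-1 : ℝ) 1, φ (X t 0) = 0 := by
    by_contra! hne
    have hs := (h.map_clm φ).isResonanceSolution hΨ (by simp [h2]) (by simp [h3])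
    have he : IsResonanceEigenfunction Ψ α _ := ⟨hs, hne⟩
    refine (hα ⟨_, he⟩ _ he).2 ?_
    simp [solJet, h1 ⟨_, he⟩]
  refine h.eq_zero_of_apply_zero (by norm_num) fun t ht => ?_
  refine RCLike.ext ?_ ?_
  · simpa using key RCLike.reCLM t ht
  · simpa using key RCLike.imCLM t ht

theorem IsResonanceSolution.isSol (hΨ : Continuous Ψ) {W : Fin 5 → ℝ → ℝ}
    (h : IsResonanceSolution Ψ α W) : IsSol (-1) 1 (fun t => α * Ψ t) fun t k => W k.castSucc t := by
  refine h.jet.isSol (by norm_num) (by fun_prop) ?_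
  filter_upwards [h.eq] with ξ hξ
  linarith

theorem resonanceEigenfunction_spec (h : α ∈ resonantSet Ψ) :
    IsResonanceEigenfunction Ψ α (resonanceEigenfunction Ψ α) := by
  rw [resonanceEigenfunction, dif_pos h]
  exact h.choose_spec

/-- The Lagrange identity for two solutions. -/
theorem IsSol.lagrange_identity (hcd : c ≤ d) {p q : ℝ → 𝕜} {Z Y : ℝ → Fin 4 → 𝕜}
    (hZ : IsSol c d p Z) (hY : IsSol c d q Y)
    (hp : ContinuousOn p (Icc c d)) (hq : ContinuousOn q (Icc c d)) :
    ∫ t in c..d, (p t - q t) * Z t 0 * Y t 0 =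
      (Z c 3 * Y c 0 - Z c 2 * Y c 1 + Z c 1 * Y c 2 - Z c 0 * Y c 3) -
      (Z d 3 * Y d 0 - Z d 2 * Y d 1 + Z d 1 * Y d 2 - Z d 0 * Y d 3) := by
  -- In the derivative of the alternating sum the mixed products cancel in pairs, and only `(p - q)
  -- Z Y` survives.
  have h := eq_add_integral_of_hasDerivWithinAt
    (f := fun t => -(Z t 3 * Y t 0 - Z t 2 * Y t 1 + Z t 1 * Y t 2 - Z t 0 * Y t 3))
    (((hp.sub hq).mul (hZ.continuousOn_apply 0)).mul (hY.continuousOn_apply 0))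
    (fun t ht => by
      have z (k) := hZ.hasDerivWithinAt_apply ht k
      have y (k) := hY.hasDerivWithinAt_apply ht k
      convert! (((((z 3).mul (y 0)).sub ((z 2).mul (y 1))).add ((z 1).mul (y 2))).sub
        ((z 0).mul (y 3))).neg using 1
      simp [companion]
      ring) d (right_mem_Icc.2 hcd)
  linear_combination -h

end Resonance

/-! ### Limits of integrals, outer limits and inner limits -/

section Limits

variable {𝕜 : Type*} [RCLike 𝕜] {ι : Type*} {c d : ℝ}

theorem tendsto_integral_mul_mul {l : Filter ι} (hcd : c ≤ d) {F G : ι → ℝ → 𝕜} {f g Y : ℝ → 𝕜}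
    (hF : ∀ᶠ i in l, ContinuousOn (F i) (Icc c d)) (hG : ∀ᶠ i in l, ContinuousOn (G i) (Icc c d))
    (hf : ContinuousOn f (Icc c d)) (hg : ContinuousOn g (Icc c d)) (hY : ContinuousOn Y (Icc c d))
    (hFf : ∀ δ > 0, ∀ᶠ i in l, ∀ t ∈ Icc c d, ‖F i t - f t‖ ≤ δ)
    (hGg : ∀ δ > 0, ∀ᶠ i in l, ∀ t ∈ Icc c d, ‖G i t - g t‖ ≤ δ) :
    Tendsto (fun i => ∫ t in c..d, F i t * G i t * Y t) l (𝓝 (∫ t in c..d, f t * g t * Y t)) := by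
  obtain ⟨Kf, hKf1, hKf⟩ := exists_norm_le_of_continuousOn hf
  obtain ⟨Kg, hKg1, hKg⟩ := exists_norm_le_of_continuousOn hg
  obtain ⟨KY, hKY1, hKY⟩ := exists_norm_le_of_continuousOn hY
  refine Metric.tendsto_nhds.2 fun η hη => ?_
  -- `Kg + 1` bounds `G i` once `δ ≤ 1`; the length is enlarged by one so that `L` is positive even
  -- for `c = d`.
  set L := (Kf + Kg + 1) * KY * (d - c + 1) with hL
  have hdc := sub_nonneg.2 hcd
  have hL0 : 0 < L := by positivity
  set δ := min 1 (η / L / 2) with hδ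
  have hδ0 : 0 < δ := lt_min one_pos (by positivity)
  filter_upwards [hF, hG, hFf δ hδ0, hGg δ hδ0] with i hFi hGi hFi' hGi'
  have hint {u : ℝ → 𝕜} (hu : ContinuousOn u (Icc c d)) : IntervalIntegrable u volume c d :=
    ContinuousOn.intervalIntegrable (by rwa [uIcc_of_le hcd])
  rw [dist_eq_norm, ← intervalIntegral.integral_sub (hint (u := fun t => F i t * G i t * Y t)
    ((hFi.mul hGi).mul hY)) (hint (u := fun t => f t * g t * Y t) ((hf.mul hg).mul hY))]
  have hb : ∀ t ∈ uIoc c d, ‖F i t * G i t * Y t - f t * g t * Y t‖ ≤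
      δ * ((Kf + Kg + 1) * KY) := by
    intro t ht
    rw [uIoc_of_le hcd] at ht
    have ht' := Ioc_subset_Icc_self ht
    have e : F i t * G i t * Y t - f t * g t * Y t =
        ((F i t - f t) * G i t + f t * (G i t - g t)) * Y t := by ring
    have h1 : ‖G i t‖ ≤ Kg + 1 := by
      have h2 := norm_le_norm_add_norm_sub' (G i t) (g t)
      have h3 := hGi' t ht'
      have h4 := hKg t ht'
      have h5 : δ ≤ 1 := min_le_left _ _
      linarith
    rw [e, norm_mul]
    calc _ ≤ (‖F i t - f t‖ * ‖G i t‖ + ‖f t‖ * ‖G i t - g t‖) * ‖Y t‖ := by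
          gcongr
          exact (norm_add_le _ _).trans (by rw [norm_mul, norm_mul])
      _ ≤ (δ * (Kg + 1) + Kf * δ) * KY := by
          gcongr
          · exact hFi' t ht'
          · exact hKf t ht'
          · exact hGi' t ht'
          · exact hKY t ht'
      _ = _ := by ring
  have h := intervalIntegral.norm_integral_le_of_norm_le_const hb
  rw [abs_of_nonneg hdc] at h
  calc _ ≤ _ := h
    _ ≤ δ * L := by
      rw [hL, mul_assoc δ]
      exact mul_le_mul_of_nonneg_left
        (mul_le_mul_of_nonneg_left (by linarith) (by positivity)) hδ0.le
    _ ≤ η / L / 2 * L := by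
      gcongr
      exact min_le_right _ _
    _ = η / 2 := by field_simp
    _ < η := half_lt_self hη

theorem tendsto_apply_of_uniform {l : Filter ι} {s : ι → Set ℝ} {f : ι → ℝ → Fin 4 → 𝕜}
    {W : ℝ → Fin 4 → 𝕜}
    (hlim : ∀ δ > 0, ∀ᶠ i in l, ∀ t ∈ s i, ‖f i t - W t‖ ≤ δ) {t : ℝ} (ht : ∀ i, t ∈ s i)
    (k : Fin 4) : Tendsto (fun i => f i t k) l (𝓝 (W t k)) := by
  have h : Tendsto (fun i => f i t) l (𝓝 (W t)) := by
    refine Metric.tendsto_nhds.2 fun δ hδ => ?_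
    filter_upwards [hlim (δ / 2) (half_pos hδ)] with i hi
    rw [dist_eq_norm]
    exact (hi t (ht i)).trans_lt (half_lt_self hδ)
  exact (tendsto_pi_nhds.1 h) k

variable {l : Ultrafilter ι} {e : ι → ℝ} {lam : ι → 𝕜} {lam₀ : 𝕜} {X : ι → ℝ → Fin 4 → 𝕜}
  {U : ℝ → ℝ} {C : ℝ}

/-- The interval `[a, a/2]` is fixed and eventually lies to the left of `-e i`, so an `L_1` bound
there controls the solution up to the moving endpoint. -/
theorem exists_isSol_limit_left {a : ℝ} (ha : a < 0) (hU : ContinuousOn U (Icc a 0))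
    (he : Tendsto e l (𝓝 0)) (he0 : ∀ᶠ i in l, 0 < e i) (hlam : Tendsto lam l (𝓝 lam₀))
    (hX : ∀ᶠ i in l, IsSol a (-e i) (fun t => (U t : 𝕜) - lam i) (X i))
    (hC : ∀ᶠ i in l, ∫ t in a..a / 2, ‖X i t 0‖ ≤ C) :
    ∃ A, IsSol a 0 (fun t => (U t : 𝕜) - lam₀) A ∧ Tendsto (fun i => X i a) l (𝓝 (A a)) ∧
      Tendsto (fun i => X i (-e i)) l (𝓝 (A 0)) ∧
      ∀ δ > 0, ∀ᶠ i in l, ∀ t ∈ Icc a (-e i), ‖X i t - A t‖ ≤ δ := by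
  have hei : ∀ᶠ i in l, a / 2 ≤ -e i ∧ -e i ≤ 0 := by
    filter_upwards [he0, he.eventually (gt_mem_nhds (show (0 : ℝ) < -a / 2 by linarith))]
      with i h1 h2
    constructor <;> linarith
  obtain ⟨A, hA, hAa, hlim⟩ := exists_isSol_limit_of_integral_le (l := l) (c := a) (m := a / 2)
    (d := 0) (by linarith) (by linarith) (q := fun t => (U t : 𝕜) - lam₀)
    ((RCLike.continuous_ofReal.comp_continuousOn hU).sub continuousOn_const)
    hei hX (fun δ hδ => by
      filter_upwards [hlam.eventually (Metric.closedBall_mem_nhds lam₀ hδ)] with i hi t _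
      rwa [sub_sub_sub_cancel_left, ← dist_eq_norm, dist_comm]) hC
  refine ⟨A, hA, hAa, ?_, hlim⟩
  exact tendsto_apply_right hA.continuousOn ha.le
    (hei.mono fun i hi => ⟨by linarith [hi.1], hi.2⟩) (by simpa using he.neg) hlim

/-- The reflection `x ↦ -x` of a curve of derivatives. -/
def reflect (X : ℝ → Fin 4 → 𝕜) (t : ℝ) (k : Fin 4) : 𝕜 := (-1) ^ (k : ℕ) * X (-t) k

theorem reflect_reflect (X : ℝ → Fin 4 → 𝕜) : reflect (reflect X) = X := by
  ext t k
  simp [reflect, ← mul_assoc, ← mul_pow]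

theorem norm_reflect_sub (X Y : ℝ → Fin 4 → 𝕜) (t : ℝ) :
    ‖reflect X t - reflect Y t‖ = ‖X (-t) - Y (-t)‖ := by
  simp only [Pi.norm_def, Pi.sub_apply, reflect, ← mul_sub, nnnorm_mul, nnnorm_pow, nnnorm_neg,
    nnnorm_one, one_pow, one_mul]

theorem IsSol.reflect {q : ℝ → 𝕜} {X : ℝ → Fin 4 → 𝕜} (h : IsSol c d q X) :
    IsSol (-d) (-c) (fun t => q (-t)) (reflect X) := by
  have := h.scale (c' := -d) (d' := -c) (-1) (fun t ht => by
    rw [neg_one_mul]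
    exact ⟨by linarith [ht.2], by linarith [ht.1]⟩)
  have h2 := this.congr (q' := fun t => q (-t)) (fun t _ => by norm_num)
  convert! h2 using 3
  simp [SingularFourthOrder.reflect]

theorem tendsto_reflect {l : Filter ι} {e : ι → ℝ} {s : ℝ} {x : ι → ℝ → Fin 4 → 𝕜}
    {A : ℝ → Fin 4 → 𝕜} (h : Tendsto (fun i => x i (e i)) l (𝓝 (A s))) :
    Tendsto (fun i => reflect (x i) (-e i)) l (𝓝 (reflect A (-s))) := by
  refine tendsto_pi_nhds.2 fun k => ?_
  simp only [reflect, neg_neg]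
  exact (tendsto_pi_nhds.1 h k).const_mul _

/-- The equation has even order, so `x ↦ -x` turns this into the left-hand case. -/
theorem exists_isSol_limit_right {b : ℝ} (hb : 0 < b) (hU : ContinuousOn U (Icc 0 b))
    (he : Tendsto e l (𝓝 0)) (he0 : ∀ᶠ i in l, 0 < e i) (hlam : Tendsto lam l (𝓝 lam₀))
    (hX : ∀ᶠ i in l, IsSol (e i) b (fun t => (U t : 𝕜) - lam i) (X i))
    (hC : ∀ᶠ i in l, ∫ t in b / 2..b, ‖X i t 0‖ ≤ C) :
    ∃ B, IsSol 0 b (fun t => (U t : 𝕜) - lam₀) B ∧ Tendsto (fun i => X i b) l (𝓝 (B b)) ∧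
      Tendsto (fun i => X i (e i)) l (𝓝 (B 0)) ∧
      ∀ δ > 0, ∀ᶠ i in l, ∀ t ∈ Icc (e i) b, ‖X i t - B t‖ ≤ δ := by
  obtain ⟨A, hA, hAa, hA0, hlim⟩ := exists_isSol_limit_left (l := l) (a := -b) (C := C)
    (U := fun t => U (-t)) (X := fun i => reflect (X i)) (by linarith)
    (hU.comp continuous_neg.continuousOn fun t ht => ⟨by linarith [ht.2], by linarith [ht.1]⟩)
    he he0 hlam (hX.mono fun i hi => hi.reflect) (by
      filter_upwards [hC] with i hi
      have := intervalIntegral.integral_comp_neg (fun t => ‖X i t 0‖) (a := -b) (b := -b / 2)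
      simp only [reflect, Fin.val_zero, pow_zero, one_mul]
      rw [this]
      convert hi using 2 <;> ring)
  refine ⟨reflect A, ?_, ?_, ?_, fun δ hδ => ?_⟩
  · simpa using hA.reflect
  · simpa [reflect_reflect] using
      tendsto_reflect (x := fun i => reflect (X i)) (e := fun _ => -b) hAa
  · simpa [reflect_reflect] using
      tendsto_reflect (x := fun i => reflect (X i)) (e := fun i => -e i) hA0
  · filter_upwards [hlim δ hδ] with i hi t ht
    have := hi (-t) ⟨by linarith [ht.2], by linarith [ht.1]⟩
    rwa [← norm_reflect_sub, reflect_reflect] at this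

variable {Ψ : ℝ → ℝ} {α : ℝ}

/-- Solutions of the perturbed inner problem with bounded slopes at the left end converge to
a resonance solution. -/
theorem exists_resonance_limit (hΨ : Continuous Ψ)
    (hα : α ∈ resonantSet Ψ → IsNondegenerate Ψ α) {p : ι → ℝ → 𝕜} {Z : ι → ℝ → Fin 4 → 𝕜}
    (hZ : ∀ᶠ i in l, IsSol (-1) 1 (p i) (Z i))
    (hp : ∀ δ > 0, ∀ᶠ i in l, ∀ t ∈ Icc (-1 : ℝ) 1, ‖p i t - ((α * Ψ t : ℝ) : 𝕜)‖ ≤ δ)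
    {z : 𝕜} (h1 : Tendsto (fun i => Z i (-1) 1) l (𝓝 z))
    (h2 : Tendsto (fun i => Z i (-1) 2) l (𝓝 0)) (h3 : Tendsto (fun i => Z i (-1) 3) l (𝓝 0))
    (h2' : Tendsto (fun i => Z i 1 2) l (𝓝 0)) (h3' : Tendsto (fun i => Z i 1 3) l (𝓝 0)) :
    ∃ W, IsSol (-1) 1 (fun t => ((α * Ψ t : ℝ) : 𝕜)) W ∧ (W (-1) 2 = 0 ∧ W 1 2 = 0) ∧
      (W (-1) 3 = 0 ∧ W 1 3 = 0) ∧ W (-1) 1 = z ∧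
      ∀ δ > 0, ∀ᶠ i in l, ∀ t ∈ Icc (-1 : ℝ) 1, ‖Z i t - W t‖ ≤ δ := by
  have hm : ∀ _ : ι, (-1 : ℝ) ∈ Icc (-1 : ℝ) 1 := fun _ => by norm_num
  have hm' : ∀ _ : ι, (1 : ℝ) ∈ Icc (-1 : ℝ) 1 := fun _ => by norm_num
  have hq : Continuous fun t => ((α * Ψ t : ℝ) : 𝕜) :=
    RCLike.continuous_ofReal.comp (continuous_const.mul hΨ)
  obtain ⟨W, hW, -, hlim⟩ := exists_isSol_limit_of_normalized (l := l) (c := -1) (d := 1)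
    (e := fun _ => 1) (by norm_num) (q := fun t => ((α * Ψ t : ℝ) : 𝕜))
    hq.continuousOn (.of_forall fun _ => by norm_num) hZ hp
    (fun r W hr hW hlim => by
      have hr' : Tendsto (fun i => (r i : 𝕜)) l (𝓝 0) := by
        simpa [Function.comp_def] using
          (RCLike.continuous_ofReal (K := 𝕜)).continuousAt.tendsto.comp hr
      -- Convergent boundary data are annihilated by multipliers tending to zero. A limit of `r i •
      -- Z i` is therefore a resonance solution with zero slope at `-1`, hence trivial.
      have key {x : ι → 𝕜} {x₀ w : 𝕜} (hx : Tendsto x l (𝓝 x₀))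
          (hw : Tendsto (fun i => (r i : 𝕜) * x i) l (𝓝 w)) : w = 0 :=
        tendsto_nhds_unique hw (by simpa using hr'.mul hx)
      refine hW.eq_zero_of_isNondegenerate hΨ hα ⟨?_, ?_⟩ ⟨?_, ?_⟩ (fun _ => ?_) _ (by norm_num)
      · exact key h2 (tendsto_apply_of_uniform hlim hm 2)
      · exact key h2' (tendsto_apply_of_uniform hlim hm' 2)
      · exact key h3 (tendsto_apply_of_uniform hlim hm 3)
      · exact key h3' (tendsto_apply_of_uniform hlim hm' 3)
      · exact key h1 (tendsto_apply_of_uniform hlim hm 1))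
  have t {s : ℝ} (hs : ∀ _ : ι, s ∈ Icc (-1 : ℝ) 1) (k : Fin 4) :=
    tendsto_apply_of_uniform hlim hs k
  exact ⟨W, hW, ⟨tendsto_nhds_unique (t hm 2) h2, tendsto_nhds_unique (t hm' 2) h2'⟩,
    ⟨tendsto_nhds_unique (t hm 3) h3, tendsto_nhds_unique (t hm' 3) h3'⟩,
    tendsto_nhds_unique (t hm 1) h1, hlim⟩

theorem theta_mul_eq (h : α ∈ resonantSet Ψ)
    (hα : α ∈ resonantSet Ψ → IsNondegenerate Ψ α) :
    resonanceEigenfunction Ψ α 1 (-1) ≠ 0 ∧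
    theta Ψ α * resonanceEigenfunction Ψ α 1 (-1) = resonanceEigenfunction Ψ α 1 1 := by
  have h1 := (hα h _ (resonanceEigenfunction_spec h)).2
  have h2 := left_ne_zero_of_mul h1
  exact ⟨h2, by rw [theta, div_mul_cancel₀ _ h2]⟩

/-- Every resonance solution is a multiple of the eigenfunction. -/
theorem IsSol.eq_mul_resonanceEigenfunction (hΨ : Continuous Ψ) (h : α ∈ resonantSet Ψ)
    (hα : α ∈ resonantSet Ψ → IsNondegenerate Ψ α) {W : ℝ → Fin 4 → 𝕜}
    (hW : IsSol (-1) 1 (fun t => ((α * Ψ t : ℝ) : 𝕜)) W) (h2 : W (-1) 2 = 0 ∧ W 1 2 = 0)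
    (h3 : W (-1) 3 = 0 ∧ W 1 3 = 0) :
    ∀ t ∈ Icc (-1 : ℝ) 1, ∀ k : Fin 4, W t k =
      W (-1) 1 / (resonanceEigenfunction Ψ α 1 (-1) : 𝕜) *
        (resonanceEigenfunction Ψ α k.castSucc t : 𝕜) := by
  set w := resonanceEigenfunction Ψ α with hw
  have hs := (resonanceEigenfunction_spec h).1
  have hw1 : (w 1 (-1) : 𝕜) ≠ 0 := by exact_mod_cast (theta_mul_eq h hα).1
  have hY := (hs.isSol hΨ).ofReal (𝕜 := 𝕜)
  have hl : w 2 (-1) = 0 ∧ w 3 (-1) = 0 := hs.left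
  have hr : w 2 1 = 0 ∧ w 3 1 = 0 := hs.right
  -- The multiple is chosen to cancel the slope at `-1`; a resonance solution with zero slope there
  -- is trivial.
  have hV := hW.sub (hY.smul (W (-1) 1 / (w 1 (-1) : 𝕜)))
  have := hV.eq_zero_of_isNondegenerate hΨ hα
    (by simp [h2, ← hw, hl, hr]) (by simp [h3, ← hw, hl, hr])
    (fun _ => by simp [← hw, hw1])
  intro t ht k
  exact sub_eq_zero.1 (congrFun (this t ht) k)

end Limits

/-! ### The rescaled equation near the origin -/

section Inner

/-- The points `±1` are covered because the support is open and so lies in the interior of `[-1,1]`.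
The outer equation therefore holds up to `±ε`. -/
theorem IsShape.eq_zero {f : ℝ → ℝ} (hf : IsShape f) {x : ℝ} (hx : x ∉ Ioo (-1 : ℝ) 1) :
    f x = 0 := by
  by_contra h
  refine hx ?_
  rw [← interior_Icc]
  exact interior_maximal ((subset_tsupport f).trans hf.2) hf.1.continuous.isOpen_support h

variable {𝕜 : Type*} [RCLike 𝕜] {U Ψ Φ Υ₁ Υ₂ : ℝ → ℝ} {α β γ₁ γ₂ : ℝ}

theorem perturbation_eq_zero (hΨ : IsShape Ψ) (hΦ : IsShape Φ) (hΥ₁ : IsShape Υ₁)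
    (hΥ₂ : IsShape Υ₂) {ε x : ℝ} (hε : 0 < ε) (hx : x ∉ Ioo (-ε) ε) :
    perturbation α β γ₁ γ₂ Ψ Φ Υ₁ Υ₂ ε x = 0 := by
  have h : ε⁻¹ * x ∉ Ioo (-1 : ℝ) 1 := by
    rintro ⟨h1, h2⟩
    rw [inv_mul_eq_div] at h1 h2
    rw [lt_div_iff₀ hε] at h1
    rw [div_lt_one hε] at h2
    exact hx ⟨by linarith, h2⟩
  simp [perturbation, hΨ.eq_zero h, hΦ.eq_zero h, hΥ₁.eq_zero h, hΥ₂.eq_zero h]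

theorem continuous_perturbation (hΨ : IsShape Ψ) (hΦ : IsShape Φ) (hΥ₁ : IsShape Υ₁)
    (hΥ₂ : IsShape Υ₂) (ε : ℝ) : Continuous (perturbation α β γ₁ γ₂ Ψ Φ Υ₁ Υ₂ ε) := by
  have h1 := hΨ.1.continuous
  have h2 := hΦ.1.continuous
  have h3 := hΥ₁.1.continuous
  have h4 := hΥ₂.1.continuous
  unfold perturbation
  fun_prop

/-- The coefficient of the rescaled equation on `(-1,1)` is `α Ψ` plus `ε` times this function. -/
def innerResidual (U : ℝ → ℝ) (β γ₁ γ₂ : ℝ) (Φ Υ₁ Υ₂ : ℝ → ℝ) (ε : ℝ) (μ : 𝕜) (ξ : ℝ) : 𝕜 :=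
  ((β * Φ ξ + ε * γ₁ * Υ₁ ξ + ε ^ 2 * γ₂ * Υ₂ ξ + ε ^ 3 * U (ε * ξ) : ℝ) : 𝕜) - (ε : 𝕜) ^ 3 * μ

/-- The factor `ε⁴` leaves `αΨ` at order zero and `βΦ` at order one; all else is of higher order.
This is why `β` enters the limit operator and `γ₁`, `γ₂` do not. -/
theorem rescaled_coefficient {ε : ℝ} (hε : ε ≠ 0) (μ : 𝕜) (ξ : ℝ) :
    (ε : 𝕜) ^ 4 * (((U (ε * ξ) + perturbation α β γ₁ γ₂ Ψ Φ Υ₁ Υ₂ ε (ε * ξ) : ℝ) : 𝕜) - μ) =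
      ((α * Ψ ξ : ℝ) : 𝕜) + ε * innerResidual U β γ₁ γ₂ Φ Υ₁ Υ₂ ε μ ξ := by
  have h : (ε : 𝕜) ≠ 0 := by exact_mod_cast hε
  simp only [perturbation, innerResidual, inv_mul_cancel_left₀ hε]
  push_cast
  field_simp
  ring

theorem innerResidual_tendsto {ι : Type*} {l : Filter ι} {a b : ℝ} (ha : a < 0) (hb : 0 < b)
    (hU : ContinuousOn U (Icc a b)) (hΥ₁ : Continuous Υ₁) (hΥ₂ : Continuous Υ₂) {e : ι → ℝ}
    {lam : ι → 𝕜} {lam₀ : 𝕜} (he : Tendsto e l (𝓝 0)) (he0 : ∀ᶠ i in l, 0 < e i)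
    (hlam : Tendsto lam l (𝓝 lam₀)) :
    ∀ δ > 0, ∀ᶠ i in l, ∀ ξ ∈ Icc (-1 : ℝ) 1,
      ‖innerResidual U β γ₁ γ₂ Φ Υ₁ Υ₂ (e i) (lam i) ξ - ((β * Φ ξ : ℝ) : 𝕜)‖ ≤ δ := by
  intro δ hδ
  obtain ⟨K₁, hK₁1, hK₁⟩ := exists_norm_le_of_continuousOn (hΥ₁.continuousOn (s := Icc (-1) 1))
  obtain ⟨K₂, hK₂1, hK₂⟩ := exists_norm_le_of_continuousOn (hΥ₂.continuousOn (s := Icc (-1) 1))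
  obtain ⟨K₃, hK₃1, hK₃⟩ := exists_norm_le_of_continuousOn hU
  -- For `e i < 1` every remaining term is at most `e i` times the matching summand of `M`.
  set M := |γ₁| * K₁ + |γ₂| * K₂ + K₃ + (‖lam₀‖ + 1) with hM
  have hM0 : 0 < M := by positivity
  filter_upwards [he0, he.eventually (gt_mem_nhds (show (0 : ℝ) < δ / M by positivity)),
    he.eventually (gt_mem_nhds one_pos), he.eventually (gt_mem_nhds hb),
    he.eventually (gt_mem_nhds (neg_pos.2 ha)),
    hlam.norm.eventually (gt_mem_nhds (lt_add_one ‖lam₀‖))] with i h0 hδi h1 hbi hai hl ξ hξ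
  have e1 : innerResidual U β γ₁ γ₂ Φ Υ₁ Υ₂ (e i) (lam i) ξ - ((β * Φ ξ : ℝ) : 𝕜) =
      ((e i * γ₁ * Υ₁ ξ + e i ^ 2 * γ₂ * Υ₂ ξ + e i ^ 3 * U (e i * ξ) : ℝ) : 𝕜) -
        ((e i : ℝ) : 𝕜) ^ 3 * lam i := by
    simp only [innerResidual]
    push_cast
    ring
  have hmem : e i * ξ ∈ Icc a b := by
    have h2 : |e i * ξ| ≤ e i := by
      rw [abs_mul, abs_of_pos h0]
      exact mul_le_of_le_one_right h0.le (abs_le.2 hξ)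
    have h3 := abs_le.1 h2
    exact ⟨by linarith, by linarith⟩
  have p2 : e i ^ 2 ≤ e i := pow_le_of_le_one h0.le h1.le two_ne_zero
  have p3 : e i ^ 3 ≤ e i := pow_le_of_le_one h0.le h1.le three_ne_zero
  have b1 : |e i * γ₁ * Υ₁ ξ| ≤ e i * (|γ₁| * K₁) := by
    rw [mul_assoc, abs_mul, abs_mul, abs_of_pos h0]
    gcongr
    exact hK₁ ξ hξ
  have b2 : |e i ^ 2 * γ₂ * Υ₂ ξ| ≤ e i * (|γ₂| * K₂) := by
    rw [mul_assoc, abs_mul, abs_mul, abs_of_pos (by positivity : 0 < e i ^ 2)]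
    gcongr
    exact hK₂ ξ hξ
  have b3 : |e i ^ 3 * U (e i * ξ)| ≤ e i * K₃ := by
    rw [abs_mul, abs_of_pos (by positivity : 0 < e i ^ 3)]
    gcongr
    exact hK₃ _ hmem
  have b4 : ‖((e i : ℝ) : 𝕜) ^ 3 * lam i‖ ≤ e i * (‖lam₀‖ + 1) := by
    rw [norm_mul, norm_pow, RCLike.norm_ofReal, abs_of_pos h0]
    gcongr
  rw [e1]
  refine (norm_sub_le _ _).trans ?_
  rw [RCLike.norm_ofReal]
  have b5 := abs_add_three (e i * γ₁ * Υ₁ ξ) (e i ^ 2 * γ₂ * Υ₂ ξ) (e i ^ 3 * U (e i * ξ))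
  have b6 : e i * M ≤ δ := ((lt_div_iff₀ hM0).1 hδi).le
  rw [hM] at b6
  linarith

/-- The inner variable: the derivatives of `ε⁻¹ x(ε ξ)` in `ξ`. -/
def innerCurve (ε : ℝ) (X : ℝ → Fin 4 → 𝕜) (ξ : ℝ) : Fin 4 → 𝕜 :=
  (ε : 𝕜)⁻¹ • fun k : Fin 4 => (ε : 𝕜) ^ (k : ℕ) * X (ε * ξ) k

theorem innerCurve_isSol {a b ε : ℝ} {μ : 𝕜} {X : ℝ → Fin 4 → 𝕜} (hε : 0 < ε) (haε : a ≤ -ε)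
    (hbε : ε ≤ b)
    (hX : IsSol a b (fun t => ((U t + perturbation α β γ₁ γ₂ Ψ Φ Υ₁ Υ₂ ε t : ℝ) : 𝕜) - μ) X) :
    IsSol (-1) 1
      (fun ξ => ((α * Ψ ξ : ℝ) : 𝕜) + ε * innerResidual U β γ₁ γ₂ Φ Υ₁ Υ₂ ε μ ξ)
      (innerCurve ε X) := by
  refine ((hX.scale (c' := -1) (d' := 1) ε fun t ht => ?_).smul (ε : 𝕜)⁻¹).congr
    fun ξ _ => (rescaled_coefficient hε.ne' μ ξ).symm
  constructor
  · nlinarith [ht.1]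
  · nlinarith [ht.2]

/-- The factor `ε⁻¹` in `innerCurve` is chosen to preserve slopes. The second and third derivatives
then gain `ε` and `ε²`, which yields the free-end conditions in the limit. -/
theorem innerCurve_one {ε : ℝ} (hε : ε ≠ 0) (X : ℝ → Fin 4 → 𝕜) (ξ : ℝ) :
    innerCurve ε X ξ 1 = X (ε * ξ) 1 := by
  have h : (ε : 𝕜) ≠ 0 := by exact_mod_cast hε
  simp [innerCurve, h]

theorem innerCurve_two {ε : ℝ} (hε : ε ≠ 0) (X : ℝ → Fin 4 → 𝕜) (ξ : ℝ) :
    innerCurve ε X ξ 2 = ε * X (ε * ξ) 2 := by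
  have h : (ε : 𝕜) ≠ 0 := by exact_mod_cast hε
  simp only [innerCurve, Pi.smul_apply, smul_eq_mul, Fin.coe_ofNat_eq_mod, Nat.reduceMod]
  field_simp

theorem innerCurve_three {ε : ℝ} (hε : ε ≠ 0) (X : ℝ → Fin 4 → 𝕜) (ξ : ℝ) :
    innerCurve ε X ξ 3 = ε * (ε * X (ε * ξ) 3) := by
  have h : (ε : 𝕜) ≠ 0 := by exact_mod_cast hε
  simp only [innerCurve, Pi.smul_apply, smul_eq_mul, Fin.coe_ofNat_eq_mod, Nat.reduceMod]
  field_simp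

theorem mul_innerCurve_zero {ε : ℝ} (hε : ε ≠ 0) (X : ℝ → Fin 4 → 𝕜) (ξ : ℝ) :
    ε * innerCurve ε X ξ 0 = X (ε * ξ) 0 := by
  have h : (ε : 𝕜) ≠ 0 := by exact_mod_cast hε
  simp [innerCurve, h]

end Inner

/-! ### Derivation of the conditions at the origin -/

section Coupling

variable {𝕜 : Type*} [RCLike 𝕜] {U Ψ Φ Υ₁ Υ₂ : ℝ → ℝ} {α β γ₁ γ₂ : ℝ} {ι : Type*}
  {l : Ultrafilter ι} {a b : ℝ} {e : ι → ℝ} {lam : ι → 𝕜} {lam₀ : 𝕜} {X : ι → ℝ → Fin 4 → 𝕜}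

/-- The inner limit: if the derivatives converge at both ends of the shrinking interval, then
the rescaled solutions converge to a resonance solution with the limiting slopes. -/
theorem exists_inner_limit (ha : a < 0) (hb : 0 < b) (hU : ContinuousOn U (Icc a b))
    (hΨ : IsShape Ψ) (hΦ : IsShape Φ) (hΥ₁ : IsShape Υ₁) (hΥ₂ : IsShape Υ₂)
    (hα : α ∈ resonantSet Ψ → IsNondegenerate Ψ α)
    (he : Tendsto e l (𝓝 0)) (he0 : ∀ᶠ i in l, 0 < e i) (hlam : Tendsto lam l (𝓝 lam₀))
    (hX : ∀ᶠ i in l, IsSol a b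
      (fun t => ((U t + perturbation α β γ₁ γ₂ Ψ Φ Υ₁ Υ₂ (e i) t : ℝ) : 𝕜) - lam i) (X i))
    {x y : Fin 4 → 𝕜} (hx : Tendsto (fun i => X i (-e i)) l (𝓝 x))
    (hy : Tendsto (fun i => X i (e i)) l (𝓝 y)) :
    ∃ W, IsSol (-1) 1 (fun t => ((α * Ψ t : ℝ) : 𝕜)) W ∧ (W (-1) 2 = 0 ∧ W 1 2 = 0) ∧
      (W (-1) 3 = 0 ∧ W 1 3 = 0) ∧ (W (-1) 1 = x 1 ∧ W 1 1 = y 1) ∧ (x 0 = 0 ∧ y 0 = 0) ∧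
      ∀ δ > 0, ∀ᶠ i in l, ∀ t ∈ Icc (-1 : ℝ) 1, ‖innerCurve (e i) (X i) t - W t‖ ≤ δ := by
  have hx' (k) := (tendsto_pi_nhds.1 hx) k
  have hy' (k) := (tendsto_pi_nhds.1 hy) k
  have heK : Tendsto (fun i => (e i : 𝕜)) l (𝓝 0) := by
    simpa [Function.comp_def] using (RCLike.continuous_ofReal (K := 𝕜)).continuousAt.tendsto.comp he
  have hZ : ∀ᶠ i in l, IsSol (-1) 1 (fun ξ => ((α * Ψ ξ : ℝ) : 𝕜) +
      e i * innerResidual U β γ₁ γ₂ Φ Υ₁ Υ₂ (e i) (lam i) ξ) (innerCurve (e i) (X i)) := by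
    filter_upwards [he0, hX, he.eventually (gt_mem_nhds hb),
      he.eventually (gt_mem_nhds (neg_pos.2 ha))] with i h0 hXi hbi hai
    exact innerCurve_isSol h0 (by linarith) hbi.le hXi
  have hp : ∀ δ > 0, ∀ᶠ i in l, ∀ ξ ∈ Icc (-1 : ℝ) 1, ‖((α * Ψ ξ : ℝ) : 𝕜) +
      e i * innerResidual U β γ₁ γ₂ Φ Υ₁ Υ₂ (e i) (lam i) ξ - ((α * Ψ ξ : ℝ) : 𝕜)‖ ≤ δ := by
    intro δ hδ
    obtain ⟨K, hK1, hK⟩ := exists_norm_le_of_continuousOn (c := -1) (d := 1)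
      (q := fun t => β * Φ t) (continuous_const.mul hΦ.1.continuous).continuousOn
    have hK0 : 0 < K + 1 := by linarith
    filter_upwards [he0, he.eventually (gt_mem_nhds (show 0 < δ / (K + 1) by positivity)),
      innerResidual_tendsto (β := β) (γ₁ := γ₁) (γ₂ := γ₂) (Φ := Φ) ha hb hU hΥ₁.1.continuous
        hΥ₂.1.continuous he he0 hlam 1 one_pos] with i h0 hδi hr ξ hξ
    rw [add_sub_cancel_left, norm_mul, RCLike.norm_ofReal, abs_of_pos h0]
    have h1 := norm_le_norm_add_norm_sub'
      (innerResidual U β γ₁ γ₂ Φ Υ₁ Υ₂ (e i) (lam i) ξ) ((β * Φ ξ : ℝ) : 𝕜)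
    have h2 := hr ξ hξ
    have h3 := hK ξ hξ
    rw [Real.norm_eq_abs, ← RCLike.norm_ofReal (K := 𝕜)] at h3
    rw [lt_div_iff₀ hK0] at hδi
    calc _ ≤ e i * (K + 1) := by
          gcongr
          linarith
      _ ≤ δ := hδi.le
  have congr {f g : ι → 𝕜} {z : 𝕜} (hg : Tendsto g l (𝓝 z))
      (hfg : ∀ i, 0 < e i → f i = g i) : Tendsto f l (𝓝 z) :=
    hg.congr' (he0.mono fun i hi => (hfg i hi).symm)
  obtain ⟨W, hW, h2, h3, h1, hlim⟩ := exists_resonance_limit hΨ.1.continuous hα hZ hp (z := x 1)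
    (congr (hx' 1) fun i hi => by rw [innerCurve_one hi.ne', mul_neg_one])
    (congr (by simpa using heK.mul (hx' 2))
      fun i hi => by rw [innerCurve_two hi.ne', mul_neg_one])
    (congr (by simpa using heK.mul (heK.mul (hx' 3)))
      fun i hi => by rw [innerCurve_three hi.ne', mul_neg_one])
    (congr (by simpa using heK.mul (hy' 2))
      fun i hi => by rw [innerCurve_two hi.ne', mul_one])
    (congr (by simpa using heK.mul (heK.mul (hy' 3)))
      fun i hi => by rw [innerCurve_three hi.ne', mul_one])
  have hm := tendsto_apply_of_uniform hlim (fun _ => by norm_num : ∀ _ : ι, (-1 : ℝ) ∈ Icc (-1) 1)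
  have hm' := tendsto_apply_of_uniform hlim (fun _ => by norm_num : ∀ _ : ι, (1 : ℝ) ∈ Icc (-1) 1)
  refine ⟨W, hW, h2, h3, ⟨h1, ?_⟩, ⟨?_, ?_⟩, hlim⟩
  · exact tendsto_nhds_unique (hm' 1)
      (congr (hy' 1) fun i hi => by rw [innerCurve_one hi.ne', mul_one])
  -- The value at `-e i` is `e i` times a convergent quantity, so its limit is zero.
  · refine tendsto_nhds_unique (hx' 0) (congr (by simpa using heK.mul (hm 0)) fun i hi => ?_)
    rw [mul_innerCurve_zero hi.ne', mul_neg_one]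
  · refine tendsto_nhds_unique (hy' 0) (congr (by simpa using heK.mul (hm' 0)) fun i hi => ?_)
    rw [mul_innerCurve_zero hi.ne', mul_one]

/-- The condition on the second derivatives in the resonant case. -/
theorem coupling_second_derivative (ha : a < 0) (hb : 0 < b) (hU : ContinuousOn U (Icc a b))
    (hΨ : IsShape Ψ) (hΦ : IsShape Φ) (hΥ₁ : IsShape Υ₁) (hΥ₂ : IsShape Υ₂)
    (hα : α ∈ resonantSet Ψ → IsNondegenerate Ψ α) (hmem : α ∈ resonantSet Ψ)
    (he : Tendsto e l (𝓝 0)) (he0 : ∀ᶠ i in l, 0 < e i) (hlam : Tendsto lam l (𝓝 lam₀))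
    (hX : ∀ᶠ i in l, IsSol a b
      (fun t => ((U t + perturbation α β γ₁ γ₂ Ψ Φ Υ₁ Υ₂ (e i) t : ℝ) : 𝕜) - lam i) (X i))
    {x y : Fin 4 → 𝕜} (hx : Tendsto (fun i => X i (-e i)) l (𝓝 x))
    (hy : Tendsto (fun i => X i (e i)) l (𝓝 y)) {W : ℝ → Fin 4 → 𝕜}
    (hW : IsSol (-1) 1 (fun t => ((α * Ψ t : ℝ) : 𝕜)) W) (h2 : W (-1) 2 = 0 ∧ W 1 2 = 0)
    (h3 : W (-1) 3 = 0 ∧ W 1 3 = 0) (h1 : W (-1) 1 = x 1)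
    (hlim : ∀ δ > 0, ∀ᶠ i in l, ∀ t ∈ Icc (-1 : ℝ) 1, ‖innerCurve (e i) (X i) t - W t‖ ≤ δ) :
    (theta Ψ α : 𝕜) * y 2 - x 2 - ((β * vartheta Φ fun ξ =>
      resonanceEigenfunction Ψ α 0 ξ / resonanceEigenfunction Ψ α 1 (-1) : ℝ) : 𝕜) * x 1 = 0 := by
  have hx' (k) := (tendsto_pi_nhds.1 hx) k
  have hy' (k) := (tendsto_pi_nhds.1 hy) k
  have heK : Tendsto (fun i => (e i : 𝕜)) l (𝓝 0) := by
    simpa [Function.comp_def] using (RCLike.continuous_ofReal (K := 𝕜)).continuousAt.tendsto.comp he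
  obtain ⟨hw1, hθ⟩ := theta_mul_eq hmem hα
  have hWw := hW.eq_mul_resonanceEigenfunction hΨ.1.continuous hmem hα h2 h3
  have hs := (resonanceEigenfunction_spec hmem).1
  set w := resonanceEigenfunction Ψ α with hw
  have hl : w 2 (-1) = 0 ∧ w 3 (-1) = 0 := hs.left
  have hr : w 2 1 = 0 ∧ w 3 1 = 0 := hs.right
  have hwK : (w 1 (-1) : 𝕜) ≠ 0 := by exact_mod_cast hw1
  have hθ' : (theta Ψ α : 𝕜) * (w 1 (-1) : 𝕜) = (w 1 1 : 𝕜) := by exact_mod_cast hθ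
  have hY := (hs.isSol hΨ.1.continuous).ofReal (𝕜 := 𝕜)
  have hΨc : Continuous fun t => ((α * Ψ t : ℝ) : 𝕜) :=
    RCLike.continuous_ofReal.comp (continuous_const.mul hΨ.1.continuous)
  have hΦc : Continuous fun t => ((β * Φ t : ℝ) : 𝕜) :=
    RCLike.continuous_ofReal.comp (continuous_const.mul hΦ.1.continuous)
  have hev : ∀ᶠ i in l, 0 < e i ∧ a ≤ -e i ∧ e i ≤ b := by
    filter_upwards [he0, he.eventually (gt_mem_nhds hb),
      he.eventually (gt_mem_nhds (neg_pos.2 ha))] with i h0 hbi hai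
    exact ⟨h0, by linarith, hbi.le⟩
  have hZ : ∀ᶠ i in l, IsSol (-1) 1 (fun ξ => ((α * Ψ ξ : ℝ) : 𝕜) +
      e i * innerResidual U β γ₁ γ₂ Φ Υ₁ Υ₂ (e i) (lam i) ξ) (innerCurve (e i) (X i)) := by
    filter_upwards [hev, hX] with i h0 hXi
    exact innerCurve_isSol h0.1 h0.2.1 h0.2.2 hXi
  have hR : ∀ᶠ i in l, ContinuousOn (innerResidual U β γ₁ γ₂ Φ Υ₁ Υ₂ (e i) (lam i))
      (Icc (-1) 1) := by
    filter_upwards [hev] with i h0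
    have hUi : ContinuousOn (fun ξ => U (e i * ξ)) (Icc (-1) 1) := by
      refine hU.comp (continuous_const.mul continuous_id).continuousOn fun ξ hξ => ⟨?_, ?_⟩
      · nlinarith [hξ.1, h0.1, h0.2.1]
      · nlinarith [hξ.2, h0.1, h0.2.2]
    have c1 := hΦ.1.continuous
    have c2 := hΥ₁.1.continuous
    have c3 := hΥ₂.1.continuous
    unfold innerResidual
    refine (RCLike.continuous_ofReal.comp_continuousOn ?_).sub continuousOn_const
    exact ContinuousOn.add (by fun_prop) (continuousOn_const.mul hUi)
  have hint := tendsto_integral_mul_mul (l := (l : Filter ι)) (c := -1) (d := 1) (by norm_num)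
    hR (hZ.mono fun i hi => hi.continuousOn_apply 0) hΦc.continuousOn (hW.continuousOn_apply 0)
    (hY.continuousOn_apply 0)
    (innerResidual_tendsto ha hb hU hΥ₁.1.continuous hΥ₂.1.continuous he he0 hlam)
    (fun δ hδ => (hlim δ hδ).mono fun i hi t ht => (norm_le_pi_norm _ 0).trans (hi t ht))
  -- The third derivatives converge at `±e i`, so the extra factor `e i` removes them.
  have hbd : Tendsto (fun i => ((e i : 𝕜) * X i (-e i) 3 * w 0 (-1) - X i (-e i) 2 * w 1 (-1)) -
      ((e i : 𝕜) * X i (e i) 3 * w 0 1 - X i (e i) 2 * w 1 1)) l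
      (𝓝 ((0 * x 3 * w 0 (-1) - x 2 * w 1 (-1)) - (0 * y 3 * w 0 1 - y 2 * w 1 1))) :=
    (((heK.mul (hx' 3)).mul_const _).sub ((hx' 2).mul_const _)).sub
      (((heK.mul (hy' 3)).mul_const _).sub ((hy' 2).mul_const _))
  -- In the Lagrange identity with `w` the coefficients differ by `e i` times the residual. The
  -- boundary terms also carry `e i`, because `w''` and `w'''` vanish at `±1`; the common factor is
  -- cancelled.
  have heq : ∀ᶠ i in l, ∫ t in (-1 : ℝ)..1, innerResidual U β γ₁ γ₂ Φ Υ₁ Υ₂ (e i) (lam i) t *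
      innerCurve (e i) (X i) t 0 * (w 0 t : 𝕜) =
      ((e i : 𝕜) * X i (-e i) 3 * w 0 (-1) - X i (-e i) 2 * w 1 (-1)) -
      ((e i : 𝕜) * X i (e i) 3 * w 0 1 - X i (e i) 2 * w 1 1) := by
    filter_upwards [hev, hZ, hR] with i h0 hZi hRi
    have hne : (e i : 𝕜) ≠ 0 := by exact_mod_cast h0.1.ne'
    have h := hZi.lagrange_identity (by norm_num) hY
      (hΨc.continuousOn.add (continuousOn_const.mul hRi)) hΨc.continuousOn
    simp only [add_sub_cancel_left, mul_assoc, intervalIntegral.integral_const_mul,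
      innerCurve_two h0.1.ne', innerCurve_three h0.1.ne'] at h
    simp only [mul_assoc]
    refine mul_left_cancel₀ hne (h.trans ?_)
    simp only [Fin.castSucc_zero, Fin.castSucc_one, show (2 : Fin 4).castSucc = 2 from rfl,
      show (3 : Fin 4).castSucc = 3 from rfl, hl, hr, mul_neg, mul_one, RCLike.ofReal_zero]
    ring
  have hfin := tendsto_nhds_unique (hint.congr' heq) hbd
  have hval : ∫ t in (-1 : ℝ)..1, ((β * Φ t : ℝ) : 𝕜) * W t 0 * (w 0 t : 𝕜) =
      ((β * vartheta Φ fun ξ => w 0 ξ / w 1 (-1) : ℝ) : 𝕜) * x 1 * w 1 (-1) := by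
    have h4 : ∫ t in (-1 : ℝ)..1, ((β * Φ t : ℝ) : 𝕜) * W t 0 * (w 0 t : 𝕜) =
        ∫ t in (-1 : ℝ)..1, (x 1 * w 1 (-1)) *
          ((β * (Φ t * (w 0 t / w 1 (-1)) ^ 2) : ℝ) : 𝕜) := by
      refine intervalIntegral.integral_congr fun t ht => ?_
      rw [uIcc_of_le (by norm_num)] at ht
      rw [hWw t ht 0, h1]
      push_cast
      field_simp
    rw [h4, intervalIntegral.integral_const_mul, RCLike.intervalIntegral_ofReal,
      intervalIntegral.integral_const_mul, vartheta]
    ring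
  rw [show (fun t => ((β * Φ t : ℝ) : 𝕜) * W t 0 *
    ((fun t (k : Fin 4) => ((w k.castSucc t : ℝ) : 𝕜)) t 0)) =
    fun t => ((β * Φ t : ℝ) : 𝕜) * W t 0 * (w 0 t : 𝕜) from rfl] at hfin
  rw [hval] at hfin
  -- The limit identity is the claim multiplied by `w'(-1)`, with `w'(1)` written as `θ w'(-1)`.
  refine (mul_eq_zero.1 ?_).resolve_right hwK
  linear_combination -hfin + y 2 * hθ'

/-- This joins the outer limits to the inner one: the outer limits supply the boundary data at `±e
i` that the inner problem needs, and the inner limit returns the conditions on `A` and `B` at the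
origin. -/
theorem exists_limit_pair {C : ℝ} (ha : a < 0) (hb : 0 < b) (hU : ContinuousOn U (Icc a b))
    (hΨ : IsShape Ψ) (hΦ : IsShape Φ) (hΥ₁ : IsShape Υ₁) (hΥ₂ : IsShape Υ₂)
    (hα : α ∈ resonantSet Ψ → IsNondegenerate Ψ α)
    (he : Tendsto e l (𝓝 0)) (he0 : ∀ᶠ i in l, 0 < e i) (hlam : Tendsto lam l (𝓝 lam₀))
    (hX : ∀ᶠ i in l, IsSol a b
      (fun t => ((U t + perturbation α β γ₁ γ₂ Ψ Φ Υ₁ Υ₂ (e i) t : ℝ) : 𝕜) - lam i) (X i))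
    (hXa : ∀ᶠ i in l, X i a 0 = 0 ∧ X i a 1 = 0) (hXb : ∀ᶠ i in l, X i b 0 = 0 ∧ X i b 1 = 0)
    (hC : ∀ᶠ i in l, ∫ t in a..b, ‖X i t 0‖ ≤ C) :
    ∃ A B, IsSol a 0 (fun t => (U t : 𝕜) - lam₀) A ∧ IsSol 0 b (fun t => (U t : 𝕜) - lam₀) B ∧
      (A a 0 = 0 ∧ A a 1 = 0) ∧ (B b 0 = 0 ∧ B b 1 = 0) ∧ (A 0 0 = 0 ∧ B 0 0 = 0) ∧
      (α ∉ resonantSet Ψ → A 0 1 = 0 ∧ B 0 1 = 0) ∧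
      (α ∈ resonantSet Ψ → B 0 1 - (theta Ψ α : 𝕜) * A 0 1 = 0 ∧
        (theta Ψ α : 𝕜) * B 0 2 - A 0 2 - ((β * vartheta Φ fun ξ =>
          resonanceEigenfunction Ψ α 0 ξ / resonanceEigenfunction Ψ α 1 (-1) : ℝ) : 𝕜) *
          A 0 1 = 0) ∧
      (∀ δ > 0, ∀ᶠ i in l, ∀ t ∈ Icc a (-e i), ‖X i t 0 - A t 0‖ ≤ δ) ∧
      (∀ δ > 0, ∀ᶠ i in l, ∀ t ∈ Icc (e i) b, ‖X i t 0 - B t 0‖ ≤ δ) ∧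
      ∃ M, ∀ᶠ i in l, ∀ t ∈ Icc (-e i) (e i), ‖X i t 0‖ ≤ M := by
  have hev : ∀ᶠ i in l, 0 < e i ∧ a < -e i ∧ e i < b := by
    filter_upwards [he0, he.eventually (gt_mem_nhds hb),
      he.eventually (gt_mem_nhds (neg_pos.2 ha))] with i h0 hbi hai
    exact ⟨h0, by linarith, hbi⟩
  have hpz {i : ι} (h0 : 0 < e i) {t : ℝ} (ht : t ∉ Ioo (-e i) (e i)) :
      (U t : 𝕜) - lam i =
        ((U t + perturbation α β γ₁ γ₂ Ψ Φ Υ₁ Υ₂ (e i) t : ℝ) : 𝕜) - lam i := by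
    rw [perturbation_eq_zero hΨ hΦ hΥ₁ hΥ₂ h0 ht, add_zero]
  have hCsub {p q : ℝ} (hap : a ≤ p) (hpq : p ≤ q) (hqb : q ≤ b) :
      ∀ᶠ i in l, ∫ t in p..q, ‖X i t 0‖ ≤ C := by
    filter_upwards [hX, hC] with i hXi hCi
    refine (intervalIntegral.integral_mono_interval hap hpq hqb
      (.of_forall fun t => norm_nonneg _) (ContinuousOn.intervalIntegrable ?_)).trans hCi
    rw [uIcc_of_le (hap.trans (hpq.trans hqb))]
    exact (hXi.continuousOn_apply 0).norm
  obtain ⟨A, hA, hAa, hA0, hAlim⟩ := exists_isSol_limit_left ha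
    (hU.mono (Icc_subset_Icc_right hb.le)) he he0 hlam (by
      filter_upwards [hX, hev] with i hXi hi
      refine (hXi.mono le_rfl (by linarith)).congr fun t ht => hpz hi.1 fun h => ?_
      linarith [ht.2, h.1]) (hCsub le_rfl (by linarith) (by linarith))
  obtain ⟨B, hB, hBb, hB0, hBlim⟩ := exists_isSol_limit_right hb
    (hU.mono (Icc_subset_Icc_left ha.le)) he he0 hlam (by
      filter_upwards [hX, hev] with i hXi hi
      refine (hXi.mono (by linarith) le_rfl).congr fun t ht => hpz hi.1 fun h => ?_
      linarith [ht.1, h.2]) (hCsub (by linarith) (by linarith) le_rfl)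
  obtain ⟨W, hW, h2, h3, ⟨h1, h1'⟩, h00, hWlim⟩ :=
    exists_inner_limit ha hb hU hΨ hΦ hΥ₁ hΥ₂ hα he he0 hlam hX hA0 hB0
  have hzero {x : ι → Fin 4 → 𝕜} {z : Fin 4 → 𝕜} (k : Fin 4) (hx : Tendsto x l (𝓝 z))
      (h : ∀ᶠ i in l, x i k = 0) : z k = 0 :=
    tendsto_nhds_unique ((tendsto_pi_nhds.1 hx) k)
      (tendsto_const_nhds.congr' (h.mono fun i hi => hi.symm))
  refine ⟨A, B, hA, hB, ⟨hzero 0 hAa (hXa.mono fun i hi => hi.1),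
    hzero 1 hAa (hXa.mono fun i hi => hi.2)⟩, ⟨hzero 0 hBb (hXb.mono fun i hi => hi.1),
    hzero 1 hBb (hXb.mono fun i hi => hi.2)⟩, h00, fun hnm => ?_, fun hmem => ⟨?_, ?_⟩,
    fun δ hδ => (hAlim δ hδ).mono fun i hi t ht => (norm_le_pi_norm _ 0).trans (hi t ht),
    fun δ hδ => (hBlim δ hδ).mono fun i hi t ht => (norm_le_pi_norm _ 0).trans (hi t ht), ?_⟩
  -- Without resonance the inner limit is zero, and its slopes at `±1` are those of `A` and `B` at
  -- `0`.
  · have hz := hW.eq_zero_of_isNondegenerate hΨ.1.continuous hα h2 h3 (fun h => absurd h hnm)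
    rw [← h1, ← h1', hz (-1) (by norm_num), hz 1 (by norm_num)]
    exact ⟨rfl, rfl⟩
  · obtain ⟨hw1, hθ⟩ := theta_mul_eq hmem hα
    have hwK : (resonanceEigenfunction Ψ α 1 (-1) : 𝕜) ≠ 0 := by exact_mod_cast hw1
    have h := hW.eq_mul_resonanceEigenfunction hΨ.1.continuous hmem hα h2 h3 1 (by norm_num) 1
    rw [h1, h1', Fin.castSucc_one, ← hθ] at h
    rw [h]
    push_cast
    field_simp
    ring
  · exact coupling_second_derivative ha hb hU hΨ hΦ hΥ₁ hΥ₂ hα hmem he he0 hlam hX hA0 hB0 hW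
      h2 h3 h1 hWlim
  · obtain ⟨K, hK1, hK⟩ := exists_norm_le_of_continuousOn hW.continuousOn
    refine ⟨K + 1, ?_⟩
    filter_upwards [hev, he.eventually (gt_mem_nhds one_pos), hWlim 1 one_pos] with i h0 hi1 hWi t ht
    have hmem : t / e i ∈ Icc (-1 : ℝ) 1 := by
      constructor
      · rw [le_div_iff₀ h0.1]
        linarith [ht.1]
      · rw [div_le_one h0.1]
        exact ht.2
    have e1 := mul_innerCurve_zero h0.1.ne' (X i) (t / e i)
    rw [mul_div_cancel₀ _ h0.1.ne'] at e1
    rw [← e1, norm_mul, RCLike.norm_ofReal, abs_of_pos h0.1]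
    have h4 := norm_le_norm_add_norm_sub' (innerCurve (e i) (X i) (t / e i)) (W (t / e i))
    have h5 := norm_le_pi_norm (innerCurve (e i) (X i) (t / e i)) 0
    have h6 := hWi _ hmem
    have h7 := hK _ hmem
    calc _ ≤ 1 * (K + 1) := by
          gcongr
          linarith
      _ = _ := one_mul _

end Coupling

/-! ### Eigenpairs of the operators and convergence in `L_2` -/

section Eigenpairs

variable {𝕜 : Type*} [RCLike 𝕜] {a b : ℝ}

theorem isEigenpair_of_mem_graph {H : Type*} [AddCommGroup H] [Module 𝕜 H] {T : H →ₗ.[𝕜] H}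
    {μ : 𝕜} {f : H} (hf : f ≠ 0) (h : (f, μ • f) ∈ T.graph) : IsEigenpair T μ f := by
  obtain ⟨x, hx, hT⟩ := (LinearPMap.mem_graph_iff T).1 h
  simp only at hx hT
  subst hx
  exact ⟨hf, x.2, hT⟩

theorem IsEigenpair.exists_isSol {Q : ℝ → ℝ} (hab : a ≤ b) (hQ : ContinuousOn Q (Icc a b)) {μ : 𝕜}
    {f : L2 𝕜 a b} (h : IsEigenpair (dirichletOperator 𝕜 a b Q) μ f) :
    ∃ X : ℝ → Fin 4 → 𝕜, IsSol a b (fun t => (Q t : 𝕜) - μ) X ∧ (X a 0 = 0 ∧ X a 1 = 0) ∧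
      (X b 0 = 0 ∧ X b 1 = 0) ∧ f =ᵐ[volume.restrict (Ioo a b)] fun t => X t 0 := by
  obtain ⟨-, hf, hT⟩ := h
  have hg : (f, μ • f) ∈ dirichletGraph 𝕜 a b Q := by
    rw [← dirichletOperator_graph]
    exact (LinearPMap.mem_graph_iff _).2 ⟨⟨f, hf⟩, rfl, hT⟩
  obtain ⟨F, hF, h1, h2, h3, h4⟩ : DirichletActs a b Q f (μ • f : L2 𝕜 a b) := hg
  refine ⟨fun t k => F k.castSucc t, hF.jet.isSol hab
    ((RCLike.continuous_ofReal.comp_continuousOn hQ).sub continuousOn_const) ?_, ⟨h1, h2⟩,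
    ⟨h3, h4⟩, hF.eq_fst⟩
  filter_upwards [hF.eq_fst, hF.eq_snd, Lp.coeFn_smul μ f] with x e1 e2 e3
  rw [e3, Pi.smul_apply, smul_eq_mul, e1] at e2
  linear_combination -e2

/-- Hölder's inequality on a bounded interval; the constant depends on the interval only. -/
theorem exists_integral_norm_le (a b : ℝ) (hab : a ≤ b) :
    ∃ K : ℝ, ∀ (f : L2 𝕜 a b) (g : ℝ → 𝕜), f =ᵐ[volume.restrict (Ioo a b)] g →
      ∫ t in a..b, ‖g t‖ ≤ ‖f‖ * K := by
  refine ⟨(volume.restrict (Ioo a b) univ ^ (1 / (1 : ENNReal).toReal - 1 /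
    (2 : ENNReal).toReal)).toReal, fun f g hfg => ?_⟩
  have h1 : ∫ t in a..b, ‖g t‖ = (eLpNorm f 1 (volume.restrict (Ioo a b))).toReal := by
    rw [intervalIntegral.integral_of_le hab, integral_Ioc_eq_integral_Ioo,
      eLpNorm_one_eq_lintegral_enorm, ← integral_norm_eq_lintegral_enorm
        (Lp.aestronglyMeasurable f)]
    exact integral_congr_ae (hfg.mono fun x hx => by simp only [hx])
  have h2 := eLpNorm_le_eLpNorm_mul_rpow_measure_univ (p := 1) (q := 2)
    (μ := volume.restrict (Ioo a b)) (by norm_num) (Lp.aestronglyMeasurable f)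
  rw [h1, Lp.norm_def, ← ENNReal.toReal_mul]
  refine ENNReal.toReal_mono (ENNReal.mul_ne_top (Lp.eLpNorm_ne_top f) ?_) h2
  exact ENNReal.rpow_ne_top_of_nonneg (by norm_num) (measure_ne_top _ _)

/-- Functions that converge uniformly outside a shrinking neighbourhood of the origin, and stay
bounded there, converge in `L_2`. -/
theorem tendsto_L2_of_uniform_off {ι : Type*} {l : Filter ι} (ha : a < 0) (hb : 0 < b)
    {e : ι → ℝ} (he : Tendsto e l (𝓝 0)) {f : ι → L2 𝕜 a b} {g : ι → ℝ → 𝕜}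
    (hfg : ∀ᶠ i in l, f i =ᵐ[volume.restrict (Ioo a b)] g i) {A B : ℝ → 𝕜}
    (hA : ContinuousOn A (Icc a 0)) (hB : ContinuousOn B (Icc 0 b))
    (hAlim : ∀ δ > 0, ∀ᶠ i in l, ∀ t ∈ Icc a (-e i), ‖g i t - A t‖ ≤ δ)
    (hBlim : ∀ δ > 0, ∀ᶠ i in l, ∀ t ∈ Icc (e i) b, ‖g i t - B t‖ ≤ δ)
    (hM : ∃ M, ∀ᶠ i in l, ∀ t ∈ Icc (-e i) (e i), ‖g i t‖ ≤ M) (he0 : ∀ᶠ i in l, 0 < e i) :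
    ∃ v : L2 𝕜 a b, Tendsto f l (𝓝 v) ∧ v =ᵐ[volume.restrict (Ioo a 0)] A ∧
      v =ᵐ[volume.restrict (Ioo 0 b)] B := by
  set μ := volume.restrict (Ioo a b) with hμ
  obtain ⟨M, hM⟩ := hM
  obtain ⟨KA, -, hKA⟩ := exists_norm_le_of_continuousOn hA
  obtain ⟨KB, -, hKB⟩ := exists_norm_le_of_continuousOn hB
  set V : ℝ → 𝕜 := fun t => if t < 0 then A t else B t with hV
  have hVA : V =ᵐ[volume.restrict (Ioo a 0)] A := by
    filter_upwards [ae_restrict_mem measurableSet_Ioo] with x hx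
    exact if_pos hx.2
  have hVB : V =ᵐ[volume.restrict (Ioo 0 b)] B := by
    filter_upwards [ae_restrict_mem measurableSet_Ioo] with x hx
    exact if_neg (not_lt.2 hx.1.le)
  have hVK : ∀ t ∈ Ioo a b, ‖V t‖ ≤ max KA KB := by
    intro t ht
    simp only [hV]
    split_ifs with h
    · exact (hKA t ⟨ht.1.le, h.le⟩).trans (le_max_left _ _)
    · exact (hKB t ⟨not_lt.1 h, ht.2.le⟩).trans (le_max_right _ _)
  have hVm : AEStronglyMeasurable V μ := by
    have h1 : AEStronglyMeasurable V (volume.restrict (Ioo a 0)) :=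
      ((hA.mono Ioo_subset_Icc_self).aestronglyMeasurable measurableSet_Ioo).congr hVA.symm
    have h2 : AEStronglyMeasurable V (volume.restrict (Ico 0 b)) := by
      rw [← Measure.restrict_congr_set Ioo_ae_eq_Ico]
      exact ((hB.mono Ioo_subset_Icc_self).aestronglyMeasurable measurableSet_Ioo).congr hVB.symm
    rw [hμ, ← Ioo_union_Ico_eq_Ioo ha hb.le]
    exact aestronglyMeasurable_union_iff.2 ⟨h1, h2⟩
  have hVL : MemLp V 2 μ := by
    refine MemLp.of_bound hVm (max KA KB) ?_
    filter_upwards [ae_restrict_mem measurableSet_Ioo] with x hx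
    exact hVK x hx
  have hvV := hVL.coeFn_toLp
  refine ⟨hVL.toLp V, ?_, EventuallyEq.trans (ae_mono (restrict_left_le hb.le) hvV) hVA,
    EventuallyEq.trans (ae_mono (restrict_right_le ha.le) hvV) hVB⟩
  refine tendsto_iff_norm_sub_tendsto_zero.2 (Metric.tendsto_nhds.2 fun η hη => ?_)
  set K := |M| + |max KA KB| with hK
  have hK0 : 0 ≤ K := by positivity
  set c := μ.real univ ^ (1 / (2 : ENNReal).toReal) with hc
  have hc0 : 0 ≤ c := by positivity
  set δ := η / (2 * (c + 1)) with hδ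
  have hδ0 : 0 < δ := by positivity
  have hsmall : ∀ᶠ i in l, K * (2 * e i) ^ (1 / (2 : ENNReal).toReal) < η / 2 := by
    have h1 : Tendsto (fun i => K * (2 * e i) ^ (1 / (2 : ENNReal).toReal)) l
        (𝓝 (K * (2 * 0) ^ (1 / (2 : ENNReal).toReal))) :=
      ((he.const_mul 2).rpow_const (Or.inr (by norm_num))).const_mul K
    refine h1.eventually (gt_mem_nhds ?_)
    rw [mul_zero, Real.zero_rpow (by norm_num), mul_zero]
    exact half_pos hη
  filter_upwards [hfg, hAlim δ hδ0, hBlim δ hδ0, hM, he0, hsmall] with i hi hAi hBi hMi h0 hs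
  have hm : MeasurableSet (Icc (-e i) (e i)) := measurableSet_Icc
  have hmt : μ (Icc (-e i) (e i)) ≠ ⊤ := measure_ne_top _ _
  -- A pointwise majorant of the difference: `δ` everywhere, plus `K` on the shrinking interval,
  -- whose measure is at most `2 * e i`.
  set G : Lp ℝ 2 μ := indicatorConstLp 2 MeasurableSet.univ (measure_ne_top μ univ) δ +
    indicatorConstLp 2 hm hmt K with hG
  have hle : ‖f i - hVL.toLp V‖ ≤ ‖G‖ := by
    refine Lp.norm_le_norm_of_ae_le ?_
    filter_upwards [hi, hvV, Lp.coeFn_sub (f i) (hVL.toLp V), Lp.coeFn_add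
      (indicatorConstLp 2 MeasurableSet.univ (measure_ne_top μ univ) δ)
      (indicatorConstLp 2 hm hmt K), indicatorConstLp_coeFn (p := 2) (μ := μ)
        (hs := MeasurableSet.univ) (hμs := measure_ne_top μ univ) (c := δ),
      indicatorConstLp_coeFn (p := 2) (hs := hm) (hμs := hmt) (c := K),
      ae_restrict_mem measurableSet_Ioo] with x e1 e2 e3 e4 e5 e6 hx
    rw [e3, Pi.sub_apply, e1, e2, hG, e4, Pi.add_apply, e5, e6, indicator_of_mem (mem_univ x)]
    by_cases hxe : x ∈ Icc (-e i) (e i)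
    · rw [indicator_of_mem hxe, Real.norm_of_nonneg (by positivity)]
      have h1 := hMi x hxe
      have h2 := hVK x hx
      have h3 := norm_sub_le (g i x) (V x)
      have h4 := le_abs_self M
      have h5 := le_abs_self (max KA KB)
      linarith
    · rw [indicator_of_notMem hxe, add_zero, Real.norm_of_nonneg hδ0.le]
      rcases lt_or_ge x (-e i) with h | h
      · have h1 : V x = A x := if_pos (by linarith)
        rw [h1]
        exact hAi x ⟨hx.1.le, h.le⟩
      · have h2 : e i < x := by
          by_contra h3
          exact hxe ⟨h, not_lt.1 h3⟩
        have h1 : V x = B x := if_neg (by linarith)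
        rw [h1]
        exact hBi x ⟨h2.le, hx.2.le⟩
  have hreal : μ.real (Icc (-e i) (e i)) ≤ 2 * e i := by
    have h1 : μ (Icc (-e i) (e i)) ≤ volume (Icc (-e i) (e i)) := Measure.restrict_apply_le _ _
    rw [Real.volume_Icc] at h1
    refine (ENNReal.toReal_mono ENNReal.ofReal_ne_top h1).trans ?_
    rw [ENNReal.toReal_ofReal (by linarith)]
    linarith
  have hGn : ‖G‖ ≤ δ * c + K * (2 * e i) ^ (1 / (2 : ENNReal).toReal) := by
    refine (norm_add_le _ _).trans ?_
    rw [norm_indicatorConstLp (by norm_num) (by norm_num),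
      norm_indicatorConstLp (by norm_num) (by norm_num), Real.norm_of_nonneg hδ0.le,
      Real.norm_of_nonneg hK0]
    gcongr
  have hδc : δ * c ≤ η / 2 := by
    calc δ * c ≤ δ * (c + 1) := by
          gcongr
          linarith
      _ = η / 2 := by
          rw [hδ]
          field_simp
  rw [dist_zero_right, norm_norm]
  linarith

theorem smul_ae_eq {c d : ℝ} (hle : volume.restrict (Ioo c d) ≤ volume.restrict (Ioo a b)) (μ : 𝕜)
    (v : L2 𝕜 a b) :
    (μ • v : L2 𝕜 a b) =ᵐ[volume.restrict (Ioo c d)] fun t => μ * v t :=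
  ae_mono hle ((Lp.coeFn_smul μ v).mono fun t ht => by rw [ht, Pi.smul_apply, smul_eq_mul])

theorem isEigenpair_limitOperator (ha : a < 0) (hb : 0 < b) {U Ψ Φ : ℝ → ℝ} {α β : ℝ}
    (hU : ContinuousOn U (Icc a b)) {v : L2 𝕜 a b} (hv : v ≠ 0) {μ : 𝕜} {A B : ℝ → Fin 4 → 𝕜}
    (hA : IsSol a 0 (fun t => (U t : 𝕜) - μ) A) (hB : IsSol 0 b (fun t => (U t : 𝕜) - μ) B)
    (hAa : A a 0 = 0 ∧ A a 1 = 0) (hBb : B b 0 = 0 ∧ B b 1 = 0) (h0 : A 0 0 = 0 ∧ B 0 0 = 0)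
    (hn : α ∉ resonantSet Ψ → A 0 1 = 0 ∧ B 0 1 = 0)
    (hr : α ∈ resonantSet Ψ → B 0 1 - (theta Ψ α : 𝕜) * A 0 1 = 0 ∧
      (theta Ψ α : 𝕜) * B 0 2 - A 0 2 - ((β * vartheta Φ fun ξ =>
        resonanceEigenfunction Ψ α 0 ξ / resonanceEigenfunction Ψ α 1 (-1) : ℝ) : 𝕜) * A 0 1 = 0)
    (hvA : v =ᵐ[volume.restrict (Ioo a 0)] fun t => A t 0)
    (hvB : v =ᵐ[volume.restrict (Ioo 0 b)] fun t => B t 0) :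
    IsEigenpair (limitOperator 𝕜 a b ha.le hb.le U α β Ψ Φ) μ v := by
  have actA := hA.actsBy (hU.mono (Icc_subset_Icc_right hb.le)) hvA
    (smul_ae_eq (restrict_left_le hb.le) μ v)
  have actB := hB.actsBy (hU.mono (Icc_subset_Icc_left ha.le)) hvB
    (smul_ae_eq (restrict_right_le ha.le) μ v)
  refine isEigenpair_of_mem_graph hv ?_
  unfold limitOperator
  split_ifs with h
  · rw [coupledOperator_graph]
    exact ⟨_, _, actA, actB, hAa, hBb, h0, (hr h).1, (hr h).2⟩
  · rw [directSumOperator_graph]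
    exact ⟨⟨_, actA, hAa.1, hAa.2, h0.1, (hn h).1⟩, ⟨_, actB, h0.2, (hn h).2, hBb.1, hBb.2⟩⟩

/-- Norm convergence implies weak convergence, and weak limits are unique. -/
theorem eq_of_tendsto_weakSpace {ι E : Type*} [NormedAddCommGroup E] [NormedSpace 𝕜 E]
    {l : Filter ι} [l.NeBot] {y : ι → E} {v v' : E}
    (h : Tendsto (fun i => toWeakSpace 𝕜 E (y i)) l (𝓝 (toWeakSpace 𝕜 E v)))
    (h' : Tendsto y l (𝓝 v')) : v' = v :=
  (toWeakSpace 𝕜 E).injective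
    (tendsto_nhds_unique (((toWeakSpaceCLM 𝕜 E).continuous.tendsto v').comp h') h)

end Eigenpairs

end SingularFourthOrder

end

/-- Convergence of eigenvalues and eigenfunctions of `S_ε` along a set `I ⊆ (0,1)` that
accumulates at `0`. -/
theorem theorem3 {𝕜 : Type*} [RCLike 𝕜] (a b : ℝ) (ha : a < 0) (hb : 0 < b)
    (U : ℝ → ℝ) (hU : ContDiffOn ℝ ∞ U (Icc a b))
    (Ψ Φ Υ₁ Υ₂ : ℝ → ℝ) (hΨ : IsShape Ψ) (hΦ : IsShape Φ) (hΥ₁ : IsShape Υ₁) (hΥ₂ : IsShape Υ₂)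
    (hsupp : tsupport Ψ = Icc (-1) 1)
    (α β γ₁ γ₂ : ℝ) (hα : α ∈ resonantSet Ψ → IsNondegenerate Ψ α)
    (I : Set ℝ) (hI : I ⊆ Ioo 0 1) (hI0 : AccPt (0 : ℝ) (𝓟 I))
    (lam : ℝ → 𝕜) (y : ℝ → L2 𝕜 a b)
    (heig : ∀ ε ∈ I, IsEigenpair
      (perturbedOperator 𝕜 a b U α β γ₁ γ₂ Ψ Φ Υ₁ Υ₂ ε) (lam ε) (y ε))
    (hnorm : ∀ ε ∈ I, ‖y ε‖ = 1)
    (lam₀ : 𝕜) (v : L2 𝕜 a b)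
    (hlam : Tendsto lam (𝓝[I] 0) (𝓝 lam₀))
    (hy : Tendsto (fun ε => toWeakSpace 𝕜 (L2 𝕜 a b) (y ε)) (𝓝[I] 0)
      (𝓝 (toWeakSpace 𝕜 (L2 𝕜 a b) v))) :
    IsEigenpair (limitOperator 𝕜 a b ha.le hb.le U α β Ψ Φ) lam₀ v ∧
      Tendsto y (𝓝[I] 0) (𝓝 v) := by
  have hUc : ContinuousOn U (Icc a b) := hU.continuousOn
  have hQc (ε : ℝ) : ContinuousOn (fun x => U x + perturbation α β γ₁ γ₂ Ψ Φ Υ₁ Υ₂ ε x)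
      (Icc a b) := hUc.add (continuous_perturbation hΨ hΦ hΥ₁ hΥ₂ ε).continuousOn
  have hsol : ∀ ε, ∃ X : ℝ → Fin 4 → 𝕜, ε ∈ I → IsSol a b
      (fun t => ((U t + perturbation α β γ₁ γ₂ Ψ Φ Υ₁ Υ₂ ε t : ℝ) : 𝕜) - lam ε) X ∧
      (X a 0 = 0 ∧ X a 1 = 0) ∧ (X b 0 = 0 ∧ X b 1 = 0) ∧
      y ε =ᵐ[volume.restrict (Ioo a b)] fun t => X t 0 := by
    intro ε
    by_cases hε : ε ∈ I
    · obtain ⟨X, hX⟩ := (heig ε hε).exists_isSol (ha.trans hb).le (hQc ε)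
      exact ⟨X, fun _ => hX⟩
    · exact ⟨0, fun h => absurd h hε⟩
  choose X hX using hsol
  obtain ⟨K, hK⟩ := exists_integral_norm_le (𝕜 := 𝕜) a b (ha.trans hb).le
  -- Along each ultrafilter compactness yields limits with no choice of subsequence, and the weak
  -- limit identifies the norm limit as the same `v` every time.
  have main : ∀ l : Ultrafilter ℝ, (l : Filter ℝ) ≤ 𝓝[I] 0 →
      IsEigenpair (limitOperator 𝕜 a b ha.le hb.le U α β Ψ Φ) lam₀ v ∧ Tendsto y l (𝓝 v) := by
    intro l hl
    have hmem : ∀ᶠ ε in l, ε ∈ I := hl self_mem_nhdsWithin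
    have he : Tendsto (fun ε : ℝ => ε) l (𝓝 0) := hl.trans nhdsWithin_le_nhds
    have he0 : ∀ᶠ ε : ℝ in l, 0 < ε := hmem.mono fun ε h => (hI h).1
    obtain ⟨A, B, hA, hB, hAa, hBb, h0, hn, hr, hAlim, hBlim, hM⟩ :=
      exists_limit_pair (C := 1 * K) ha hb hUc hΨ hΦ hΥ₁ hΥ₂ hα he he0 (hlam.mono_left hl)
        (hmem.mono fun ε h => (hX ε h).1) (hmem.mono fun ε h => (hX ε h).2.1)
        (hmem.mono fun ε h => (hX ε h).2.2.1)
        (hmem.mono fun ε h => by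
          have := hK (y ε) _ (hX ε h).2.2.2
          rwa [hnorm ε h] at this)
    obtain ⟨v', hv', hvA, hvB⟩ := tendsto_L2_of_uniform_off ha hb he
      (hmem.mono fun ε h => (hX ε h).2.2.2) (hA.continuousOn_apply 0) (hB.continuousOn_apply 0)
      hAlim hBlim hM he0
    obtain rfl := eq_of_tendsto_weakSpace (hy.mono_left hl) hv'
    have hv0 : v' ≠ 0 := by
      rintro rfl
      have h1 : Tendsto (fun ε => ‖y ε‖) l (𝓝 1) :=
        tendsto_const_nhds.congr' (hmem.mono fun ε h => (hnorm ε h).symm)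
      have h2 := tendsto_nhds_unique hv'.norm h1
      rw [norm_zero] at h2
      exact zero_ne_one h2
    exact ⟨isEigenpair_limitOperator ha hb hUc hv0 hA hB hAa hBb h0 hn hr hvA hvB, hv'⟩
  -- Since `0` is an accumulation point of `I`, at least one ultrafilter exists, which gives the
  -- eigenpair; norm convergence uses all of them.
  have hne : (𝓝[I] (0 : ℝ)).NeBot := by
    have h1 : (𝓝[≠] (0 : ℝ) ⊓ 𝓟 I).NeBot := hI0
    exact h1.mono (inf_le_inf_right _ nhdsWithin_le_nhds)
  exact ⟨(main (Ultrafilter.of (𝓝[I] 0)) (Ultrafilter.of_le _)).1,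
    tendsto_iff_ultrafilter _ _ _ |>.2 fun l hl => (main l hl).2⟩
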